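/- A stochastically continuous real-valued process $\xi(t)$, $t\ge 0$, is called time-stable if for every $n\ge 2$ the sum of $n$ i.i.d. copies of $\xi$ has the same finite-dimensional distributions as the process $t\mapsto \xi(nt)$. A process is said to have no Gaussian component if each of its finite-dimensional distributions is infinitely divisible with a Lévy triplet whose Gaussian covariance matrix is zero (the drift and the Lévy measure are arbitrary). Let $\xi$ be a time-stable process. Then there exist a constant $c\in\mathbb{R}$, a function $C:[0,\infty)^2\to\mathbb{R}$ satisfying $$C(ut,us)=u\,C(t,s)\qquad\text{for all } t,s,u\ge 0,$$ and, on some probability space, a centred Gaussian process $G(t)$, $t\ge0$, with covariance function $C$ and a time-stable process $\eta(t)$, $t\ge 0$, with no Gaussian component, such that $G$ and $\eta$ are independent and $\xi$ has the same finite-dimensional distributions as the process $$c\,t+G(t)+\eta(t),\qquad t\ge 0 .$$ -/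

import Mathlib

open MeasureTheory ProbabilityTheory Filter Topology
open scoped NNReal ENNReal

namespace TimeStable

noncomputable section

/-- Equality of all finite-dimensional distributions of two real processes indexed by
`[0, ∞)`, possibly living on different probability spaces. -/
def EqFDD {Ω Ω' : Type*} [MeasurableSpace Ω] [MeasurableSpace Ω']
    (X : ℝ≥0 → Ω → ℝ) (P : Measure Ω) (Y : ℝ≥0 → Ω' → ℝ) (P' : Measure Ω') : Prop :=
  ∀ I : Finset ℝ≥0,
    IdentDistrib (fun ω => I.restrict (fun t => X t ω)) (fun ω => I.restrict (fun t => Y t ω)) P P'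

/-- Stochastic continuity: `X s → X t` in probability as `s → t`, for every `t ≥ 0`. -/
def StochasticallyContinuous {Ω : Type*} [MeasurableSpace Ω]
    (X : ℝ≥0 → Ω → ℝ) (P : Measure Ω) : Prop :=
  ∀ t : ℝ≥0, TendstoInMeasure P X (𝓝 t) (X t)

/-- The sum of `n` independent copies of `X`, realised on the product space `Ωⁿ` with the product
measure `P ⊗ ⋯ ⊗ P`; the `i`-th copy is `X` read off the `i`-th coordinate. -/
def sumOfCopies {Ω : Type*} (X : ℝ≥0 → Ω → ℝ) (n : ℕ) : ℝ≥0 → (Fin n → Ω) → ℝ :=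
  fun t ω => ∑ i, X t (ω i)

/-- A time-stable process: a stochastically continuous real-valued process on `[0, ∞)` such that
for each `n ≥ 2` the sum of `n` i.i.d. copies has the finite-dimensional distributions of the
time-scaled process `t ↦ X (n t)`. -/
structure IsTimeStable {Ω : Type*} [MeasurableSpace Ω]
    (X : ℝ≥0 → Ω → ℝ) (P : Measure Ω) : Prop where
  isProbabilityMeasure : IsProbabilityMeasure P
  measurable : ∀ t, Measurable (X t)
  stochasticallyContinuous : StochasticallyContinuous X P
  stable : ∀ n : ℕ, 2 ≤ n →
    EqFDD (sumOfCopies X n) (Measure.pi fun _ : Fin n => P) (fun t => X ((n : ℝ≥0) * t)) P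

/-- The Lévy function `L(u) = u` for `|u| ≤ 1`, `L(u) = 1` for `u > 1`, `L(u) = -1` for
`u < -1`. -/
def levyFun (u : ℝ) : ℝ := max (-1) (min 1 u)

/-- The measure `μ` on `ℝ^ι` is infinitely divisible with Lévy triplet `(b, A, ν)` with respect to
the Lévy function `levyFun` (applied coordinatewise): its characteristic function has the
Lévy–Khintchine form with drift `b`, Gaussian covariance matrix `A` and Lévy measure `ν`. -/
structure HasLevyTriplet {ι : Type*} [Fintype ι] (μ : Measure (ι → ℝ))
    (b : ι → ℝ) (A : Matrix ι ι ℝ) (ν : Measure (ι → ℝ)) : Prop where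
  posSemidef : A.PosSemidef
  zero_null : ν {0} = 0
  lintegral_lt_top : ∫⁻ x, ENNReal.ofReal (min 1 (‖x‖ ^ 2)) ∂ν < ∞
  charFun_eq : ∀ θ : ι → ℝ,
    ∫ x, Complex.exp (Complex.I * ((∑ j, θ j * x j : ℝ) : ℂ)) ∂μ =
      Complex.exp (Complex.I * ((∑ j, θ j * b j : ℝ) : ℂ)
        - (((∑ j, ∑ k, θ j * A j k * θ k) / 2 : ℝ) : ℂ)
        + ∫ x, (Complex.exp (Complex.I * ((∑ j, θ j * x j : ℝ) : ℂ)) - 1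
            - Complex.I * ((∑ j, θ j * levyFun (x j) : ℝ) : ℂ)) ∂ν)

/-- A process has no Gaussian component: each of its finite-dimensional distributions is infinitely
divisible with a Lévy triplet whose Gaussian covariance matrix is zero. -/
def HasNoGaussianComponent {Ω : Type*} [MeasurableSpace Ω]
    (X : ℝ≥0 → Ω → ℝ) (P : Measure Ω) : Prop :=
  ∀ I : Finset ℝ≥0, ∃ (b : I → ℝ) (ν : Measure (I → ℝ)),
    HasLevyTriplet (P.map fun ω => I.restrict (fun t => X t ω)) b 0 ν

/-- `G` is a centred Gaussian process with covariance function `C`. -/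
structure IsCentredGaussian {Ω : Type*} [MeasurableSpace Ω]
    (G : ℝ≥0 → Ω → ℝ) (C : ℝ≥0 → ℝ≥0 → ℝ) (P : Measure Ω) : Prop where
  measurable : ∀ t, Measurable (G t)
  isGaussianProcess : IsGaussianProcess G P
  centred : ∀ t, ∫ ω, G t ω ∂P = 0
  covariance_eq : ∀ t s, cov[G t, G s; P] = C t s

end

end TimeStable

namespace TimeStable

noncomputable section

/-! Fix times τ and let φ_s be the characteristic function of the vector of the ξ(s τ_i).
Time-stability says φ_{ns} = φ_s ^ n, and stochastic continuity brings φ_s close to φ_0 = 1 for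
small s, uniformly for bounded arguments. Logarithms can therefore be taken without branch trouble
and φ_{1/n} = exp(ψ / n): every finite-dimensional law is infinitely divisible, its n-th convolution
root being the law at the times τ / n. `exists_levyExponent` turns this into a Lévy–Khintchine
representation.

The Gaussian matrix A in it is intrinsic. Jumps contribute only o(r²) to log |φ(rθ)|, so -2 log
|φ(rθ)| / r² tends to the quadratic form of A at θ (`tendsto_re_levyExponent_div_sq`). Polarization
gives a single function `gaussCov` of two times whose values along any finite family form the
Gaussian matrix there (`gaussCov_eq`); hence it is positive semidefinite. It is homogeneous of
degree one because log |φ_u| = u log |φ_1| for every real u ≥ 0 (`IsTimeStable.log_norm_fdch_mul`).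

Dividing φ by its Gaussian factor leaves the exponential of a Lévy exponent with zero Gaussian
matrix, which is again a characteristic function (`isCharFun_exp_levyExponent`). Both factors depend
only on the random variable ∑ θ_j ξ(τ_j), so they are consistent, and Kolmogorov extension yields
laws for G and η; a product measure makes the two independent. The power law passes to η since both
φ and the Gaussian factor obey it, and η is stochastically continuous since the Gaussian variance of
an increment is at most -2 log |φ|. The drift stays inside η, so c = 0 suffices. -/

/-- The characteristic functional `E exp(i Y)` of a real random variable. -/
def ch {Ω : Type*} [MeasurableSpace Ω] (P : Measure Ω) (Y : Ω → ℝ) : ℂ :=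
  ∫ ω, Complex.exp (Complex.I * (Y ω : ℂ)) ∂P

/-- The linear form `x ↦ ∑ j, θ j * x j` on `ℝ^ι`. -/
def lin {ι : Type*} [Fintype ι] (θ x : ι → ℝ) : ℝ := ∑ j, θ j * x j

/-! ### Characteristic functions on `ι → ℝ` -/

section ch

variable {Ω Ω' : Type*} [MeasurableSpace Ω] [MeasurableSpace Ω']

theorem norm_exp_I_mul (x : ℝ) : ‖Complex.exp (Complex.I * (x : ℂ))‖ = 1 := by
  rw [mul_comm]; exact Complex.norm_exp_ofReal_mul_I x

theorem integrable_exp_I_mul {P : Measure Ω} [IsFiniteMeasure P] {Y : Ω → ℝ}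
    (hY : AEMeasurable Y P) :
    Integrable (fun ω => Complex.exp (Complex.I * (Y ω : ℂ))) P :=
  Integrable.of_bound (C := 1) (by fun_prop) (ae_of_all _ fun ω => (norm_exp_I_mul _).le)

theorem norm_ch_le_one (P : Measure Ω) [IsProbabilityMeasure P] (Y : Ω → ℝ) : ‖ch P Y‖ ≤ 1 := by
  refine (norm_integral_le_of_norm_le_const (C := 1)
    (ae_of_all _ fun ω => (norm_exp_I_mul _).le)).trans_eq (by simp)

theorem ch_zero (P : Measure Ω) [IsProbabilityMeasure P] : ch P (fun _ => 0) = 1 := by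
  simp [ch]

theorem ch_map {P : Measure Ω} {X : Ω → Ω'} (hX : AEMeasurable X P) {Y : Ω' → ℝ}
    (hY : Measurable Y) : ch (P.map X) Y = ch P (fun ω => Y (X ω)) := by
  rw [ch, integral_map hX]
  · rfl
  · fun_prop

theorem ch_prod_add (P : Measure Ω) (P' : Measure Ω') [SFinite P] [SFinite P']
    (Y : Ω → ℝ) (Y' : Ω' → ℝ) :
    ch (P.prod P') (fun p => Y p.1 + Y' p.2) = ch P Y * ch P' Y' := by
  simp only [ch, Complex.ofReal_add, mul_add, Complex.exp_add]
  exact integral_prod_mul (fun ω => Complex.exp (Complex.I * (Y ω : ℂ)))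
    fun ω => Complex.exp (Complex.I * (Y' ω : ℂ))

theorem ch_pi_sum (P : Measure Ω) [SigmaFinite P] (n : ℕ) (Y : Ω → ℝ) :
    ch (Measure.pi fun _ : Fin n => P) (fun ω => ∑ i, Y (ω i)) = ch P Y ^ n := by
  simp only [ch, Complex.ofReal_sum, Finset.mul_sum, Complex.exp_sum]
  rw [integral_fintype_prod_eq_prod (𝕜 := ℂ)
    (fun (_ : Fin n) ω => Complex.exp (Complex.I * (Y ω : ℂ)))]
  simp

theorem measurable_lin {ι : Type*} [Fintype ι] (θ : ι → ℝ) : Measurable (lin θ) := by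
  unfold lin; fun_prop

theorem continuous_lin {ι : Type*} [Fintype ι] (θ : ι → ℝ) : Continuous (lin θ) := by
  unfold lin; fun_prop

theorem continuous_lin_left {ι : Type*} [Fintype ι] (x : ι → ℝ) :
    Continuous fun θ => lin θ x := by
  unfold lin; fun_prop

theorem lin_smul {ι : Type*} [Fintype ι] (r : ℝ) (θ x : ι → ℝ) :
    lin (r • θ) x = r * lin θ x := by
  simp [lin, Finset.mul_sum, mul_assoc]

theorem lin_add {ι : Type*} [Fintype ι] (θ x y : ι → ℝ) :
    lin θ (x + y) = lin θ x + lin θ y := by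
  simp [lin, Finset.sum_add_distrib, mul_add]

theorem lin_zero {ι : Type*} [Fintype ι] (x : ι → ℝ) : lin 0 x = 0 := by
  simp [lin]

theorem lin_single {ι : Type*} [Fintype ι] [DecidableEq ι] (j : ι) (t : ℝ) (x : ι → ℝ) :
    lin (Pi.single j t) x = t * x j := by
  rw [lin, Finset.sum_eq_single j] <;> simp +contextual

theorem abs_lin_le {ι : Type*} [Fintype ι] (θ x : ι → ℝ) :
    |lin θ x| ≤ (∑ j, |θ j|) * ‖x‖ := by
  rw [lin, Finset.sum_mul]
  refine (Finset.abs_sum_le_sum_abs _ _).trans (Finset.sum_le_sum fun j _ => ?_)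
  rw [abs_mul]
  exact mul_le_mul_of_nonneg_left (norm_le_pi_norm x j) (abs_nonneg _)

theorem continuous_ch_lin {ι : Type*} [Fintype ι] (P : Measure Ω) [IsFiniteMeasure P]
    {X : Ω → ι → ℝ} (hX : Measurable X) : Continuous fun θ => ch P (fun ω => lin θ (X ω)) := by
  refine continuous_of_dominated (bound := fun _ => 1) (fun θ => ?_)
    (fun θ => ae_of_all _ fun ω => (norm_exp_I_mul _).le) (integrable_const _)
    (ae_of_all _ fun ω => ?_)
  · have := (measurable_lin θ).comp hX
    exact (Complex.measurable_exp.comp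
      ((Complex.measurable_ofReal.comp this).const_mul _)).aestronglyMeasurable
  · have := continuous_lin_left (X ω)
    fun_prop

/-- `charFun` needs an inner product, which the sup-normed space `ι → ℝ` does not carry; this is the
bridge to the Euclidean space. -/
theorem charFun_map_toLp {ι : Type*} [Fintype ι] (μ : Measure (ι → ℝ)) (θ : EuclideanSpace ℝ ι) :
    charFun (μ.map (WithLp.toLp 2)) θ = ch μ (lin (WithLp.ofLp θ)) := by
  rw [charFun_apply, ← MeasurableEquiv.coe_toLp, integral_map_equiv, ch]
  congr 1 with x
  simp [lin, PiLp.inner_apply, mul_comm]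

theorem measure_ext_of_ch {ι : Type*} [Fintype ι] {μ ν : Measure (ι → ℝ)} [IsFiniteMeasure μ]
    [IsFiniteMeasure ν] (h : ∀ θ, ch μ (lin θ) = ch ν (lin θ)) : μ = ν := by
  refine (MeasurableEquiv.toLp 2 (ι → ℝ)).map_measurableEquiv_injective ?_
  rw [MeasurableEquiv.coe_toLp]
  refine Measure.ext_of_charFun ?_
  ext θ
  rw [charFun_map_toLp, charFun_map_toLp, h]

theorem identDistrib_of_ch {ι : Type*} [Fintype ι] {P : Measure Ω} {P' : Measure Ω'}
    [IsFiniteMeasure P] [IsFiniteMeasure P'] {X : Ω → ι → ℝ} {Y : Ω' → ι → ℝ}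
    (hX : Measurable X) (hY : Measurable Y)
    (h : ∀ θ, ch P (fun ω => lin θ (X ω)) = ch P' (fun ω => lin θ (Y ω))) :
    IdentDistrib X Y P P' := by
  refine ⟨hX.aemeasurable, hY.aemeasurable, measure_ext_of_ch fun θ => ?_⟩
  rw [ch_map hX.aemeasurable (measurable_lin θ), ch_map hY.aemeasurable (measurable_lin θ), h]

end ch

/-! ### Closure properties: products, limits, compound Poisson laws -/

section IsCharFun

variable {ι : Type*} [Fintype ι]

/-- The function `f` on `ℝ^ι` is the characteristic function of a probability measure. -/
def IsCharFun (f : (ι → ℝ) → ℂ) : Prop :=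
  ∃ μ : Measure (ι → ℝ), IsProbabilityMeasure μ ∧ ∀ θ, ch μ (lin θ) = f θ

theorem IsCharFun.mul {f g : (ι → ℝ) → ℂ} (hf : IsCharFun f) (hg : IsCharFun g) :
    IsCharFun fun θ => f θ * g θ := by
  obtain ⟨μ, hμ, hf⟩ := hf
  obtain ⟨ν, hν, hg⟩ := hg
  refine ⟨(μ.prod ν).map fun p => p.1 + p.2,
    Measure.isProbabilityMeasure_map (by fun_prop), fun θ => ?_⟩
  rw [ch_map (by fun_prop) (measurable_lin θ)]
  beta_reduce
  rw [← hf, ← hg, ← ch_prod_add]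
  simp only [lin_add]

theorem isCharFun_exp_I_lin (b : ι → ℝ) :
    IsCharFun fun θ => Complex.exp (Complex.I * (lin θ b : ℂ)) :=
  ⟨Measure.dirac b, inferInstance, fun θ => by
    rw [ch, integral_dirac' _ _ (by have := measurable_lin θ; fun_prop)]⟩

theorem isCharFun_one : IsCharFun fun _ : ι → ℝ => 1 := by
  simpa [lin] using isCharFun_exp_I_lin (0 : ι → ℝ)

theorem IsCharFun.pow {f : (ι → ℝ) → ℂ} (hf : IsCharFun f) (n : ℕ) :
    IsCharFun fun θ => f θ ^ n := by
  induction n with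
  | zero => simpa using isCharFun_one
  | succ n ih => simpa only [pow_succ] using ih.mul hf

/-- **Lévy's continuity theorem**: a pointwise limit of characteristic functions that is
continuous at the origin is a characteristic function. -/
theorem IsCharFun.of_tendsto {f : ℕ → (ι → ℝ) → ℂ} {g : (ι → ℝ) → ℂ}
    (hf : ∀ n, IsCharFun (f n)) (hlim : ∀ θ, Tendsto (fun n => f n θ) atTop (𝓝 (g θ)))
    (hg : ContinuousAt g 0) : IsCharFun g := by
  choose μ hμ hμf using hf
  set ν : ℕ → ProbabilityMeasure (EuclideanSpace ℝ ι) := fun n =>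
    ⟨(μ n).map (WithLp.toLp 2), Measure.isProbabilityMeasure_map (by fun_prop)⟩
  have hν (n : ℕ) (θ) : charFun (ν n : Measure (EuclideanSpace ℝ ι)) θ = f n (WithLp.ofLp θ) := by
    rw [← hμf, ← charFun_map_toLp]; rfl
  have htight : IsTightMeasureSet (Set.range fun n => (ν n : Measure (EuclideanSpace ℝ ι))) := by
    refine isTightMeasureSet_of_tendsto_charFun (f := fun θ => g (WithLp.ofLp θ)) ?_ fun θ => ?_
    · refine ContinuousAt.comp (f := fun θ : EuclideanSpace ℝ ι => WithLp.ofLp θ) ?_ ?_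
      · simpa using hg
      · exact (PiLp.continuous_ofLp 2 _).continuousAt
    · simp_rw [hν]; exact hlim _
  have hcomp : IsCompact (closure (Set.range ν)) := isCompact_closure_of_isTightMeasureSet (by
    convert htight using 1
    ext m; simp)
  -- A limit along an ultrafilter replaces a convergent subsequence; it is enough, since pointwise
  -- convergence already fixes the characteristic function of κ.
  obtain ⟨κ, -, hκ⟩ := hcomp.ultrafilter_le_nhds ((hyperfilter ℕ).map ν) (by
    rw [Ultrafilter.coe_map, le_principal_iff, mem_map]
    exact Eventually.of_forall fun n => subset_closure ⟨n, rfl⟩)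
  have hκ' : Tendsto ν (hyperfilter ℕ : Filter ℕ) (𝓝 κ) := hκ
  rw [ProbabilityMeasure.tendsto_iff_forall_integral_rclike_tendsto ℂ] at hκ'
  refine ⟨(κ : Measure (EuclideanSpace ℝ ι)).map WithLp.ofLp,
    Measure.isProbabilityMeasure_map (by fun_prop), fun θ => ?_⟩
  have h1 : ch ((κ : Measure (EuclideanSpace ℝ ι)).map WithLp.ofLp) (lin θ)
      = charFun (κ : Measure (EuclideanSpace ℝ ι)) (WithLp.toLp 2 θ) := by
    rw [← WithLp.ofLp_toLp 2 θ, ← charFun_map_toLp, Measure.map_map (by fun_prop) (by fun_prop)]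
    simp [Function.comp_def]
  rw [h1]
  have h2 := hκ' (BoundedContinuousFunction.innerProbChar (WithLp.toLp 2 θ))
  simp_rw [← charFun_eq_integral_innerProbChar, hν] at h2
  exact tendsto_nhds_unique h2 ((hlim θ).mono_left Nat.hyperfilter_le_atTop)

/-- A convex combination of `1` and a characteristic function, written with a finite measure. -/
theorem isCharFun_one_add_integral {ν : Measure (ι → ℝ)} [IsFiniteMeasure ν]
    (h : ν Set.univ ≤ 1) :
    IsCharFun fun θ => 1 + ∫ x, (Complex.exp (Complex.I * (lin θ x : ℂ)) - 1) ∂ν := by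
  refine ⟨(1 - ν Set.univ) • Measure.dirac 0 + ν, ⟨?_⟩, fun θ => ?_⟩
  · simp [tsub_add_cancel_of_le h]
  · have hint : Integrable (fun x => Complex.exp (Complex.I * (lin θ x : ℂ))) ν :=
      integrable_exp_I_mul (measurable_lin θ).aemeasurable
    have hm : Measurable fun x => Complex.exp (Complex.I * (lin θ x : ℂ)) := by
      have := measurable_lin θ; fun_prop
    have hd : Integrable (fun x => Complex.exp (Complex.I * (lin θ x : ℂ)))
        ((1 - ν Set.univ) • Measure.dirac (0 : ι → ℝ)) :=
      (integrable_exp_I_mul (measurable_lin θ).aemeasurable).smul_measure (by simp)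
    rw [ch, integral_add_measure hd hint, integral_smul_measure, integral_dirac' _ _
      hm.stronglyMeasurable]
    beta_reduce
    rw [integral_sub hint (integrable_const _), ENNReal.toReal_sub_of_le h (by simp)]
    simp [lin, measureReal_def, sub_smul]
    ring

/-- The compound Poisson law with finite intensity measure `ν`. -/
theorem isCharFun_exp_integral (ν : Measure (ι → ℝ)) [IsFiniteMeasure ν] :
    IsCharFun fun θ =>
      Complex.exp (∫ x, (Complex.exp (Complex.I * (lin θ x : ℂ)) - 1) ∂ν) := by
  obtain ⟨N, hN⟩ := ENNReal.exists_nat_gt (measure_ne_top ν Set.univ)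
  set z : (ι → ℝ) → ℂ := fun θ => ∫ x, (Complex.exp (Complex.I * (lin θ x : ℂ)) - 1) ∂ν
  have hN0 : 0 < N := by
    rcases Nat.eq_zero_or_pos N with rfl | h
    · simp at hN
    · exact h
  have hcont : Continuous z := by
    have hc := continuous_ch_lin ν (measurable_id (α := ι → ℝ))
    have : z = fun θ => ch ν (fun ω => lin θ (id ω)) - ∫ _, (1 : ℂ) ∂ν := by
      ext θ
      exact integral_sub (integrable_exp_I_mul (measurable_lin θ).aemeasurable)
        (integrable_const _)
    rw [this]
    fun_prop
  -- Poisson limit (1 + z/m)^m → exp z. The shift m = n + N, with N above the mass of ν, makes ν/m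
  -- have mass at most 1, so that each 1 + z/m belongs to a genuine mixture with the point mass at
  -- 0.
  refine IsCharFun.of_tendsto (f := fun n θ => (1 + z θ / ((n + N : ℕ) : ℂ)) ^ (n + N))
    (fun n => ?_) (fun θ => ?_) (Complex.continuous_exp.comp hcont).continuousAt
  · have hpos : ((n + N : ℕ) : ℝ≥0∞) ≠ 0 := by simp; lia
    have : IsFiniteMeasure (((n + N : ℕ) : ℝ≥0∞)⁻¹ • ν) :=
      Measure.smul_finite _ (ENNReal.inv_ne_top.2 hpos)
    have h := isCharFun_one_add_integral (ν := ((n + N : ℕ) : ℝ≥0∞)⁻¹ • ν) (by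
      rw [Measure.smul_apply, smul_eq_mul, ← ENNReal.div_eq_inv_mul]
      refine ENNReal.div_le_of_le_mul ?_
      rw [one_mul]
      exact hN.le.trans (by push_cast; exact le_add_self))
      (ι := ι)
    have h' := IsCharFun.pow h (n + N)
    convert h' using 4 with θ
    rw [integral_smul_measure, ENNReal.toReal_inv, ENNReal.toReal_natCast, Complex.real_smul]
    push_cast
    rw [div_eq_inv_mul]
  · exact (Complex.tendsto_one_add_div_pow_exp (z θ)).comp (tendsto_add_atTop_nat N)

end IsCharFun

/-! ### Bounds for the Lévy function and Taylor remainders -/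

theorem abs_levyFun_le_one (u : ℝ) : |levyFun u| ≤ 1 := by
  rw [levyFun, abs_le]
  exact ⟨le_max_left _ _, max_le (by norm_num) (min_le_left _ _)⟩

theorem levyFun_of_abs_le {u : ℝ} (h : |u| ≤ 1) : levyFun u = u := by
  rw [abs_le] at h
  rw [levyFun, min_eq_right h.2, max_eq_right h.1]

theorem abs_levyFun_le (u : ℝ) : |levyFun u| ≤ |u| := by
  rcases le_total |u| 1 with h | h
  · rw [levyFun_of_abs_le h]
  · exact (abs_levyFun_le_one u).trans h

theorem continuous_levyFun : Continuous levyFun := by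
  unfold levyFun; fun_prop

theorem norm_exp_I_mul_sub_le (y : ℝ) :
    ‖Complex.exp (Complex.I * (y : ℂ)) - 1 - Complex.I * (y : ℂ)‖ ≤ |y| ^ 2 * Real.exp |y| := by
  have h := Complex.norm_exp_sub_sum_le_norm_mul_exp (Complex.I * (y : ℂ)) 2
  simpa [Finset.sum_range_succ, sub_sub] using h

theorem norm_exp_I_mul_sub_add_le (y : ℝ) :
    ‖Complex.exp (Complex.I * (y : ℂ)) - 1 - Complex.I * (y : ℂ) + ((y ^ 2 / 2 : ℝ) : ℂ)‖ ≤
      |y| ^ 3 * Real.exp |y| := by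
  have h := Complex.norm_exp_sub_sum_le_norm_mul_exp (Complex.I * (y : ℂ)) 3
  simp [Finset.sum_range_succ, mul_pow] at h
  convert h using 2
  push_cast
  ring

theorem norm_exp_I_mul_sub_one_le_two (y : ℝ) :
    ‖Complex.exp (Complex.I * (y : ℂ)) - 1‖ ≤ 2 := by
  refine (norm_sub_le _ _).trans ?_
  rw [norm_exp_I_mul, norm_one]; norm_num

/-! ### Lévy exponents and laws without Gaussian part -/

section Levy

variable {ι : Type*} [Fintype ι]

/-- The weight `min 1 ‖x‖²` against which Lévy measures are finite. -/
def levyWeight (x : ι → ℝ) : ℝ := min 1 (‖x‖ ^ 2)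

/-- The Lévy function applied to each coordinate. -/
def levyVec (x : ι → ℝ) : ι → ℝ := fun j => levyFun (x j)

/-- The integrand of the Lévy–Khintchine formula. -/
def levyIntegrand (θ x : ι → ℝ) : ℂ :=
  Complex.exp (Complex.I * (lin θ x : ℂ)) - 1 - Complex.I * (lin θ (levyVec x) : ℂ)

theorem levyWeight_nonneg (x : ι → ℝ) : 0 ≤ levyWeight x := by
  unfold levyWeight; positivity

theorem levyWeight_zero : levyWeight (0 : ι → ℝ) = 0 := by
  simp [levyWeight]

theorem levyWeight_pos {x : ι → ℝ} (hx : x ≠ 0) : 0 < levyWeight x := by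
  have := norm_pos_iff.2 hx
  unfold levyWeight; positivity

theorem continuous_levyWeight : Continuous (levyWeight : (ι → ℝ) → ℝ) := by
  unfold levyWeight; fun_prop

theorem continuous_levyVec {ι : Type*} : Continuous (levyVec : (ι → ℝ) → ι → ℝ) :=
  continuous_pi fun j => continuous_levyFun.comp (continuous_apply j)

theorem levyVec_of_norm_le {x : ι → ℝ} (h : ‖x‖ ≤ 1) : levyVec x = x :=
  funext fun j => levyFun_of_abs_le ((norm_le_pi_norm x j).trans h)

theorem abs_levyFun_mul_le (x : ι → ℝ) (j k : ι) :
    |levyFun (x j) * levyFun (x k)| ≤ levyWeight x := by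
  rw [abs_mul, levyWeight, le_min_iff]
  constructor
  · exact mul_le_one₀ (abs_levyFun_le_one _) (abs_nonneg _) (abs_levyFun_le_one _)
  · rw [sq]
    exact mul_le_mul ((abs_levyFun_le _).trans (norm_le_pi_norm x j))
      ((abs_levyFun_le _).trans (norm_le_pi_norm x k)) (abs_nonneg _) (norm_nonneg _)

theorem norm_levyVec_le_one (x : ι → ℝ) : ‖levyVec x‖ ≤ 1 :=
  (pi_norm_le_iff_of_nonneg zero_le_one).2 fun _ => abs_levyFun_le_one _

theorem abs_lin_levyVec_le (θ x : ι → ℝ) : |lin θ (levyVec x)| ≤ ∑ j, |θ j| :=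
  (abs_lin_le θ _).trans (mul_le_of_le_one_right (by positivity) (norm_levyVec_le_one x))

theorem continuous_levyIntegrand (θ : ι → ℝ) : Continuous (levyIntegrand θ) := by
  have h1 := continuous_lin θ
  have h2 := (continuous_lin θ).comp (continuous_levyVec (ι := ι))
  unfold levyIntegrand
  simp only [Function.comp_def] at h2
  fun_prop

theorem continuous_levyIntegrand_left (x : ι → ℝ) : Continuous fun θ => levyIntegrand θ x := by
  have h1 := continuous_lin_left x
  have h2 := continuous_lin_left (levyVec x)
  unfold levyIntegrand
  fun_prop

/-- In the unit ball the compensator is the linear Taylor term, leaving a quadratic remainder;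
outside it everything is bounded. The free parameter T makes the bound uniform over bounded sets of
θ. -/
theorem norm_levyIntegrand_le (θ x : ι → ℝ) {T : ℝ} (hT : ∑ j, |θ j| ≤ T) :
    ‖levyIntegrand θ x‖ ≤ (2 + T + T ^ 2 * Real.exp T) * levyWeight x := by
  have hT0 : 0 ≤ T := le_trans (by positivity) hT
  rcases le_total ‖x‖ 1 with h | h
  · have hw : levyWeight x = ‖x‖ ^ 2 := min_eq_right (pow_le_one₀ (norm_nonneg _) h)
    have hy : |lin θ x| ≤ T * ‖x‖ :=
      (abs_lin_le θ x).trans (mul_le_mul_of_nonneg_right hT (norm_nonneg _))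
    have hy1 : |lin θ x| ≤ T := hy.trans (mul_le_of_le_one_right hT0 h)
    rw [levyIntegrand, levyVec_of_norm_le h, hw]
    calc _ ≤ |lin θ x| ^ 2 * Real.exp |lin θ x| := norm_exp_I_mul_sub_le _
      _ ≤ (T * ‖x‖) ^ 2 * Real.exp T := by gcongr
      _ = T ^ 2 * Real.exp T * ‖x‖ ^ 2 := by ring
      _ ≤ _ := by gcongr; linarith
  · have hw : levyWeight x = 1 := min_eq_left (one_le_pow₀ h)
    rw [hw, mul_one]
    calc ‖levyIntegrand θ x‖ ≤ 2 + |lin θ (levyVec x)| := by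
          refine (norm_sub_le _ _).trans (add_le_add (norm_exp_I_mul_sub_one_le_two _) ?_)
          simp
      _ ≤ 2 + T := by gcongr; exact (abs_lin_levyVec_le θ x).trans hT
      _ ≤ _ := le_add_of_nonneg_right (by positivity)

variable {ν : Measure (ι → ℝ)}

theorem integrable_levyWeight (hν : ∫⁻ x, ENNReal.ofReal (min 1 (‖x‖ ^ 2)) ∂ν < ∞) :
    Integrable levyWeight ν :=
  ⟨continuous_levyWeight.aestronglyMeasurable, by
    rwa [hasFiniteIntegral_iff_ofReal (ae_of_all _ levyWeight_nonneg)]⟩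

theorem integrable_levyIntegrand (hν : Integrable levyWeight ν) (θ : ι → ℝ) :
    Integrable (levyIntegrand θ) ν :=
  (hν.const_mul _).mono' (continuous_levyIntegrand θ).aestronglyMeasurable
    (ae_of_all _ fun x => norm_levyIntegrand_le θ x le_rfl)

theorem sum_abs_le (θ : ι → ℝ) : ∑ j, |θ j| ≤ Fintype.card ι * ‖θ‖ := by
  calc ∑ j, |θ j| ≤ ∑ _j : ι, ‖θ‖ := Finset.sum_le_sum fun j _ => norm_le_pi_norm θ j
    _ = _ := by simp

theorem continuous_integral_levyIntegrand (hν : Integrable levyWeight ν) :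
    Continuous fun θ => ∫ x, levyIntegrand θ x ∂ν := by
  refine continuous_iff_continuousAt.2 fun θ₀ => ?_
  refine continuousAt_of_dominated
    (bound := fun x => (2 + Fintype.card ι * (‖θ₀‖ + 1) + (Fintype.card ι * (‖θ₀‖ + 1)) ^ 2 *
      Real.exp (Fintype.card ι * (‖θ₀‖ + 1))) * levyWeight x)
    (Eventually.of_forall fun θ => (continuous_levyIntegrand θ).aestronglyMeasurable) ?_
    (hν.const_mul _) (ae_of_all _ fun x => (continuous_levyIntegrand_left x).continuousAt)
  filter_upwards [Metric.ball_mem_nhds θ₀ one_pos] with θ hθ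
  refine ae_of_all _ fun x => norm_levyIntegrand_le θ x ((sum_abs_le θ).trans ?_)
  have : ‖θ‖ ≤ ‖θ₀‖ + 1 := by
    have := norm_le_norm_add_norm_sub' θ θ₀
    rw [Metric.mem_ball, dist_eq_norm] at hθ
    linarith
  gcongr

theorem re_levyIntegrand (θ x : ι → ℝ) :
    (levyIntegrand θ x).re = Real.cos (lin θ x) - 1 := by
  simp [levyIntegrand, Complex.exp_re]

theorem re_integral_levyIntegrand (hν : Integrable levyWeight ν) (θ : ι → ℝ) :
    (∫ x, levyIntegrand θ x ∂ν).re = ∫ x, (Real.cos (lin θ x) - 1) ∂ν := by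
  have := integral_re (𝕜 := ℂ) (integrable_levyIntegrand hν θ)
  simp only [RCLike.re_eq_complex_re, re_levyIntegrand] at this
  exact this.symm

/-- The jump part of a Lévy exponent grows slower than quadratically. -/
theorem tendsto_re_integral_levyIntegrand_div_sq (hν : Integrable levyWeight ν) (θ : ι → ℝ) :
    Tendsto (fun r : ℝ => (∫ x, levyIntegrand (r • θ) x ∂ν).re / r ^ 2) atTop (𝓝 0) := by
  simp_rw [re_integral_levyIntegrand hν, ← integral_div, lin_smul]
  set T := ∑ j, |θ j|
  have h0 : (0 : ℝ) = ∫ x : ι → ℝ, 0 ∂ν := by simp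
  rw [h0]
  -- For r ≥ 1, both 1 - cos y ≤ 2 and 1 - cos y ≤ y²/2 survive division by r² as bounds free of r,
  -- the first used for large x and the second for small x. Pointwise the quotient is at most 2/r².
  refine tendsto_integral_filter_of_dominated_convergence
    (bound := fun x => (2 + T ^ 2) * levyWeight x) (Eventually.of_forall fun r => ?_) ?_
    (hν.const_mul _) (ae_of_all _ fun x => ?_)
  · have := continuous_lin θ
    exact Continuous.aestronglyMeasurable (by fun_prop)
  · filter_upwards [eventually_ge_atTop 1] with r hr
    refine ae_of_all _ fun x => ?_
    have hr0 : 0 < r := by linarith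
    have hcos1 := Real.cos_le_one (r * lin θ x)
    have hcos2 := Real.neg_one_le_cos (r * lin θ x)
    have hcos3 := Real.one_sub_sq_div_two_le_cos (x := r * lin θ x)
    rw [Real.norm_eq_abs, abs_div, abs_of_nonpos (by linarith), abs_of_pos (by positivity),
      div_le_iff₀ (by positivity)]
    have hr2 : 1 ≤ r ^ 2 := one_le_pow₀ hr
    rcases le_total ‖x‖ 1 with h | h
    · have hw : levyWeight x = ‖x‖ ^ 2 := min_eq_right (pow_le_one₀ (norm_nonneg _) h)
      have hy : lin θ x ^ 2 ≤ T ^ 2 * ‖x‖ ^ 2 := by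
        rw [← mul_pow, ← sq_abs]
        exact pow_le_pow_left₀ (abs_nonneg _) (abs_lin_le θ x) 2
      rw [hw]
      nlinarith [mul_le_mul_of_nonneg_right hy (sq_nonneg r), sq_nonneg (r * ‖x‖)]
    · have hw : levyWeight x = 1 := min_eq_left (one_le_pow₀ h)
      rw [hw]
      nlinarith [sq_nonneg T, mul_nonneg (sq_nonneg T) (sq_nonneg r)]
  · refine squeeze_zero_norm' (a := fun r : ℝ => 2 / r ^ 2) ?_ ?_
    · filter_upwards [eventually_gt_atTop 0] with r hr
      have hcos1 := Real.cos_le_one (r * lin θ x)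
      have hcos2 := Real.neg_one_le_cos (r * lin θ x)
      rw [Real.norm_eq_abs, abs_div, abs_of_nonpos (by linarith), abs_of_pos (by positivity)]
      gcongr; linarith
    · exact tendsto_const_nhds.div_atTop (tendsto_pow_atTop two_ne_zero)

/-- The Lévy exponent with drift `b`, covariance `A` and Lévy measure `ν`. -/
def levyExponent (b : ι → ℝ) (A : Matrix ι ι ℝ) (ν : Measure (ι → ℝ)) (θ : ι → ℝ) : ℂ :=
  Complex.I * (lin θ b : ℂ) - (((∑ j, ∑ k, θ j * A j k * θ k) / 2 : ℝ) : ℂ)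
    + ∫ x, levyIntegrand θ x ∂ν

/-- The quadratic form of `A` is determined by the behaviour of the Lévy exponent at infinity. -/
theorem tendsto_re_levyExponent_div_sq (hν : Integrable levyWeight ν) (b : ι → ℝ)
    (A : Matrix ι ι ℝ) (θ : ι → ℝ) :
    Tendsto (fun r : ℝ => -2 * (levyExponent b A ν (r • θ)).re / r ^ 2) atTop
      (𝓝 (∑ j, ∑ k, θ j * A j k * θ k)) := by
  have h := (tendsto_re_integral_levyIntegrand_div_sq hν θ).const_mul (-2)
  have h' := (tendsto_const_nhds (x := ∑ j, ∑ k, θ j * A j k * θ k)).add h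
  rw [mul_zero, add_zero] at h'
  refine h'.congr' ?_
  filter_upwards [eventually_gt_atTop 0] with r hr
  have hq : ∑ j, ∑ k, (r • θ) j * A j k * (r • θ) k
      = r ^ 2 * ∑ j, ∑ k, θ j * A j k * θ k := by
    simp only [Finset.mul_sum, Pi.smul_apply, smul_eq_mul]
    refine Finset.sum_congr rfl fun j _ => Finset.sum_congr rfl fun k _ => by ring
  rw [levyExponent, hq]
  simp only [Complex.add_re, Complex.sub_re, Complex.mul_re, Complex.I_re, Complex.I_im,
    Complex.ofReal_re, Complex.ofReal_im]
  field_simp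
  ring

/-- The law with Lévy triplet `(b, 0, ν)`. -/
theorem isCharFun_exp_levyExponent (hν : Integrable levyWeight ν) (b : ι → ℝ) :
    IsCharFun fun θ => Complex.exp (levyExponent b 0 ν θ) := by
  -- Small jumps are cut off: integrability of `levyWeight` leaves finite ν-mass on each `S n`,
  -- hence a compound Poisson law.
  set S : ℕ → Set (ι → ℝ) := fun n => {x | 1 / ((n : ℝ) + 1) ≤ levyWeight x}
  have hS n : MeasurableSet (S n) := measurableSet_le measurable_const
    continuous_levyWeight.measurable
  have hfin n : IsFiniteMeasure (ν.restrict (S n)) := by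
    constructor
    rw [Measure.restrict_apply_univ]
    exact hν.measure_ge_lt_top (by positivity)
  have hvec n (j : ι) : Integrable (fun x : ι → ℝ => levyFun (x j)) (ν.restrict (S n)) :=
    Integrable.of_bound (C := 1)
      (continuous_levyFun.comp (continuous_apply j)).aestronglyMeasurable
      (ae_of_all _ fun x => abs_levyFun_le_one _)
  -- The compensator of the remaining jumps is moved into the drift, so that drift plus compound
  -- Poisson has the truncated Lévy exponent.
  set c : ℕ → ι → ℝ := fun n j => b j - ∫ x in S n, levyFun (x j) ∂ν
  have hlin n θ : lin θ (c n) = lin θ b - ∫ x in S n, lin θ (levyVec x) ∂ν := by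
    simp only [lin, c, levyVec, mul_sub, Finset.sum_sub_distrib]
    rw [integral_finsetSum _ fun j _ => (hvec n j).const_mul _]
    simp_rw [integral_const_mul]
  have hint n θ : Integrable (fun x => lin θ (levyVec x)) (ν.restrict (S n)) :=
    integrable_finsetSum _ fun j _ => (hvec n j).const_mul _
  refine IsCharFun.of_tendsto (fun n => (isCharFun_exp_I_lin (c n)).mul
    (isCharFun_exp_integral (ν.restrict (S n)))) (fun θ => ?_) ?_
  · have hlim : Tendsto (fun n => ∫ x in S n, levyIntegrand θ x ∂ν) atTop
        (𝓝 (∫ x, levyIntegrand θ x ∂ν)) := by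
      simp_rw [fun n => (integral_indicator (μ := ν) (f := levyIntegrand θ) (hS n)).symm]
      refine tendsto_integral_of_dominated_convergence (fun x => ‖levyIntegrand θ x‖)
        (fun n => ((continuous_levyIntegrand θ).aestronglyMeasurable.indicator (hS n)))
        (integrable_levyIntegrand hν θ).norm
        (fun n => ae_of_all _ fun x => norm_indicator_le_norm_self _ _)
        (ae_of_all _ fun x => ?_)
      -- The origin lies in no `S n`; this is harmless because the integrand vanishes there.
      by_cases hx : x = 0
      · have : levyIntegrand θ x = 0 := by
          have := norm_levyIntegrand_le θ x le_rfl
          rw [hx, levyWeight_zero, mul_zero] at this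
          rw [hx]; exact norm_le_zero_iff.1 this
        simp only [Set.indicator, this, ite_self]
        exact tendsto_const_nhds
      · refine tendsto_const_nhds.congr' ?_
        have := tendsto_one_div_add_atTop_nhds_zero_nat (𝕜 := ℝ)
        filter_upwards [this.eventually (gt_mem_nhds (levyWeight_pos hx))] with n hn
        rw [Set.indicator_of_mem]
        exact hn.le
    have heq n : Complex.exp (Complex.I * (lin θ (c n) : ℂ)) *
        Complex.exp (∫ x in S n, (Complex.exp (Complex.I * (lin θ x : ℂ)) - 1) ∂ν)
        = Complex.exp (Complex.I * (lin θ b : ℂ) + ∫ x in S n, levyIntegrand θ x ∂ν) := by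
      have h1 : ∫ x in S n, levyIntegrand θ x ∂ν
          = ∫ x in S n, (Complex.exp (Complex.I * (lin θ x : ℂ)) - 1) ∂ν
            - Complex.I * ((∫ x in S n, lin θ (levyVec x) ∂ν : ℝ) : ℂ) := by
        unfold levyIntegrand
        rw [integral_sub, integral_const_mul, integral_complex_ofReal]
        · exact (integrable_exp_I_mul (measurable_lin θ).aemeasurable).sub (integrable_const _)
        · exact (hint n θ).ofReal.const_mul _
      rw [← Complex.exp_add, h1, hlin]
      congr 1
      push_cast
      ring
    simp only [heq]
    have : levyExponent b 0 ν θ = Complex.I * (lin θ b : ℂ) + ∫ x, levyIntegrand θ x ∂ν := by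
      simp [levyExponent]
    rw [this]
    exact (Complex.continuous_exp.tendsto _).comp (hlim.const_add _)
  · have h1 := continuous_integral_levyIntegrand hν
    have h2 := continuous_lin_left b
    unfold levyExponent
    simp only [Matrix.zero_apply, mul_zero, zero_mul, Finset.sum_const_zero, zero_div,
      Complex.ofReal_zero, sub_zero]
    fun_prop

end Levy

/-! ### Uniform estimates for the convolution roots -/

section LevyKhintchine

variable {ι : Type*} [Fintype ι]

/-- The classical truncation inequality, applied to a one-dimensional marginal: a tail is controlled
by the average of 1 - φ near the origin. -/
theorem measureReal_abs_eval_gt_le [DecidableEq ι] (μ : Measure (ι → ℝ)) [IsProbabilityMeasure μ]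
    (j : ι) {r ε : ℝ} (hr : 0 < r)
    (h : ∀ t : ℝ, |t| ≤ 2 / r → ‖1 - ch μ (lin (Pi.single j t))‖ ≤ ε) :
    μ.real {x | r < |x j|} ≤ 2 * ε := by
  have hm : Measurable fun x : ι → ℝ => x j := measurable_pi_apply j
  have := Measure.isProbabilityMeasure_map (μ := μ) hm.aemeasurable
  have key := measureReal_abs_gt_le_integral_charFun (μ := μ.map fun x => x j) hr
  have hset : MeasurableSet {x : ℝ | r < |x|} :=
    measurableSet_lt measurable_const measurable_norm
  have hcf t : charFun (μ.map fun x => x j) t = ch μ (lin (Pi.single j t)) := by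
    rw [charFun_apply_real, integral_map hm.aemeasurable (by fun_prop), ch]
    congr 1 with x
    rw [lin_single]
    push_cast
    ring_nf
  have hbound := intervalIntegral.norm_integral_le_of_norm_le_const
    (a := -2 * r⁻¹) (b := 2 * r⁻¹) (C := ε) (f := fun t => 1 - charFun (μ.map fun x => x j) t)
    fun t ht => by
      rw [hcf]
      refine h t ?_
      have hle : -2 * r⁻¹ ≤ 2 * r⁻¹ := by
        have := inv_pos.2 hr
        nlinarith
      rw [Set.uIoc_of_le hle] at ht
      rw [abs_le, div_eq_mul_inv]
      exact ⟨by linarith [ht.1], ht.2⟩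
  rw [map_measureReal_apply hm hset] at key
  refine key.trans ((mul_le_mul_of_nonneg_left hbound (by positivity)).trans_eq ?_)
  rw [abs_of_pos (by have := inv_pos.2 hr; nlinarith)]
  field_simp
  ring

/-- Where |x j| > r the integrand is at most 1. Elsewhere y = x j / r satisfies |y| ≤ 1, and 1 - cos
y ≥ (2/π²) y² ≥ y²/5 gives the constant 5. -/
theorem integral_min_one_sq_le [DecidableEq ι] (μ : Measure (ι → ℝ)) [IsProbabilityMeasure μ]
    (j : ι) {r : ℝ} (hr : 0 < r) :
    ∫ x, min 1 (x j ^ 2) ∂μ ≤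
      μ.real {x | r < |x j|} + 5 * r ^ 2 * ‖1 - ch μ (lin (Pi.single j (1 / r)))‖ := by
  have hm : Measurable fun x : ι → ℝ => x j := measurable_pi_apply j
  have hset : MeasurableSet {x : ι → ℝ | r < |x j|} :=
    measurableSet_lt measurable_const (by fun_prop)
  have hcos : Integrable (fun x : ι → ℝ => 1 - Real.cos (1 / r * x j)) μ :=
    Integrable.of_bound (C := 2) (Continuous.aestronglyMeasurable (by fun_prop)) (ae_of_all _ fun x => by
      have h1 := Real.cos_le_one (1 / r * x j)
      have h2 := Real.neg_one_le_cos (1 / r * x j)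
      rw [Real.norm_eq_abs, abs_le]
      constructor <;> linarith)
  have hind : Integrable ({x : ι → ℝ | r < |x j|}.indicator (1 : (ι → ℝ) → ℝ)) μ :=
    (integrable_const (1 : ℝ)).indicator hset
  have hre : ∫ x, (1 - Real.cos (1 / r * x j)) ∂μ
      = (1 - ch μ (lin (Pi.single j (1 / r)))).re := by
    have hi := integrable_exp_I_mul (P := μ) (measurable_lin (Pi.single j (1 / r))).aemeasurable
    have := integral_re (𝕜 := ℂ) ((integrable_const (1 : ℂ)).sub hi)
    rw [show (1 - ch μ (lin (Pi.single j (1 / r))))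
      = ∫ x, ((1 : ℂ) - Complex.exp (Complex.I * (lin (Pi.single j (1 / r)) x : ℂ))) ∂μ by
        rw [integral_sub (integrable_const _) hi]; simp [ch]]
    refine Eq.trans ?_ this
    congr 1 with x
    simp [Complex.exp_re, lin_single]
  calc ∫ x, min 1 (x j ^ 2) ∂μ
      ≤ ∫ x, ({x : ι → ℝ | r < |x j|}.indicator (1 : (ι → ℝ) → ℝ) x
          + 5 * r ^ 2 * (1 - Real.cos (1 / r * x j))) ∂μ := by
        refine integral_mono (Integrable.of_bound (C := 1)
          (Continuous.aestronglyMeasurable (by fun_prop)) (ae_of_all _ fun x => by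
          rw [Real.norm_eq_abs, abs_of_nonneg (by positivity)]
          exact min_le_left _ _)) (hind.add (hcos.const_mul _)) fun x => ?_
        have hc0 : 0 ≤ 1 - Real.cos (1 / r * x j) := by linarith [Real.cos_le_one (1 / r * x j)]
        by_cases hx : r < |x j|
        · beta_reduce
          rw [Set.indicator_of_mem (by exact hx), Pi.one_apply]
          exact (min_le_left _ _).trans (le_add_of_nonneg_right (by positivity))
        · beta_reduce
          rw [Set.indicator_of_notMem (by exact hx), zero_add]
          refine (min_le_right _ _).trans ?_
          have hy : |1 / r * x j| ≤ 1 := by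
            rw [abs_mul, abs_of_pos (by positivity : 0 < 1 / r), one_div, inv_mul_le_iff₀ hr,
              mul_one]
            exact not_lt.1 hx
          have hpi := Real.pi_gt_three
          have hq := Real.cos_le_one_sub_mul_cos_sq (hy.trans (by linarith))
          have hpi2 : 1 / 5 ≤ 2 / Real.pi ^ 2 := by
            rw [div_le_div_iff₀ (by norm_num) (by positivity)]
            have := Real.pi_lt_d2
            nlinarith
          have hxy : x j ^ 2 = r ^ 2 * (1 / r * x j) ^ 2 := by field_simp
          rw [hxy]
          have := mul_le_mul_of_nonneg_right hpi2 (sq_nonneg (1 / r * x j))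
          nlinarith [sq_nonneg r]
    _ = μ.real {x | r < |x j|} + 5 * r ^ 2 * ∫ x, (1 - Real.cos (1 / r * x j)) ∂μ := by
        rw [integral_add hind (hcos.const_mul _), integral_const_mul, integral_indicator_one hset]
    _ ≤ _ := by
        rw [hre]
        gcongr
        exact Complex.re_le_norm _

/-- Absorbs the factor n + 1: the rescaled defect of the n-th root from 1 is controlled by the
exponent alone, uniformly in n. -/
theorem mul_norm_one_sub_exp_div_le (n : ℕ) {z : ℂ} (hz : ‖z‖ ≤ 1) :
    ((n : ℝ) + 1) * ‖1 - Complex.exp (z / ((n : ℂ) + 1))‖ ≤ 2 * ‖z‖ := by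
  have hn : ‖(n : ℂ) + 1‖ = (n : ℝ) + 1 := by
    rw [← Nat.cast_succ, Complex.norm_natCast]; push_cast; rfl
  have hn0 : (0 : ℝ) < (n : ℝ) + 1 := by positivity
  have h1 : ‖z / ((n : ℂ) + 1)‖ = ‖z‖ / ((n : ℝ) + 1) := by rw [norm_div, hn]
  have h2 : ‖z / ((n : ℂ) + 1)‖ ≤ 1 := by
    rw [h1, div_le_one hn0]
    have : (0 : ℝ) ≤ n := by positivity
    linarith
  have h3 := Complex.norm_exp_sub_one_le h2
  rw [norm_sub_rev]
  calc _ ≤ ((n : ℝ) + 1) * (2 * (‖z‖ / ((n : ℝ) + 1))) := by rw [← h1]; gcongr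
    _ = 2 * ‖z‖ := by field_simp

theorem tendsto_mul_exp_div_sub_one (z : ℂ) :
    Tendsto (fun n : ℕ => ((n : ℂ) + 1) * (Complex.exp (z / ((n : ℂ) + 1)) - 1)) atTop (𝓝 z) := by
  have hd : HasDerivAt (fun t : ℂ => Complex.exp (z * t)) z 0 := by
    have := ((hasDerivAt_id (0 : ℂ)).const_mul z).cexp
    simpa using this
  have hs := hasDerivAt_iff_tendsto_slope_zero.1 hd
  have hlim : Tendsto (fun n : ℕ => (1 : ℂ) / ((n : ℂ) + 1)) atTop (𝓝[≠] 0) := by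
    refine tendsto_nhdsWithin_iff.2 ⟨tendsto_one_div_add_atTop_nhds_zero_nat (𝕜 := ℂ), ?_⟩
    exact Eventually.of_forall fun n => one_div_ne_zero (Nat.cast_add_one_ne_zero n)
  refine (hs.comp hlim).congr fun n => ?_
  simp [div_eq_mul_inv]

theorem levyWeight_le_sum (x : ι → ℝ) : levyWeight x ≤ ∑ j, min 1 (x j ^ 2) := by
  rcases isEmpty_or_nonempty ι with h | h
  · have : x = 0 := Subsingleton.elim _ _
    simp [this, levyWeight_zero]
  · obtain ⟨j, hj⟩ : ∃ j, ‖x j‖ = ‖x‖ := by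
      obtain ⟨j, hj⟩ := Finite.exists_max fun j => ‖x j‖
      exact ⟨j, le_antisymm (norm_le_pi_norm x j)
        ((pi_norm_le_iff_of_nonneg (norm_nonneg _)).2 hj)⟩
    have : levyWeight x = min 1 (x j ^ 2) := by rw [levyWeight, ← hj, Real.norm_eq_abs, sq_abs]
    rw [this]
    exact Finset.single_le_sum (f := fun j => min 1 (x j ^ 2)) (fun i _ => by positivity)
      (Finset.mem_univ j)

variable {μ : ℕ → Measure (ι → ℝ)} [∀ n, IsProbabilityMeasure (μ n)] {ψ : (ι → ℝ) → ℂ}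

/-- Uniform control of the rescaled laws `(n + 1) μₙ` away from and near the origin. -/
theorem exists_uniform_tail_bound (hψ : ContinuousAt ψ 0) (hψ0 : ψ 0 = 0)
    (h : ∀ n θ, ch (μ n) (lin θ) = Complex.exp (ψ θ / ((n : ℂ) + 1))) {ε : ℝ} (hε : 0 < ε) :
    ∃ r : ℝ, 0 < r ∧ ∀ (n : ℕ) j, ((n : ℝ) + 1) * (μ n).real {x | r < |x j|} ≤ ε ∧
      ((n : ℝ) + 1) * ∫ x, min 1 (x j ^ 2) ∂(μ n) ≤ ε + 5 * r ^ 2 * ε := by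
  classical
  -- The bound 1 is the range of `mul_norm_one_sub_exp_div_le`; the quarter pays for the factor 2
  -- there and the factor 2 in the tail inequality.
  set ε' := min 1 (ε / 4)
  have hε' : 0 < ε' := by positivity
  obtain ⟨δ, hδ, hδψ⟩ := Metric.continuousAt_iff.1 hψ ε' hε'
  have hsmall (n : ℕ) (j : ι) (t : ℝ) (ht : |t| < δ) :
      ((n : ℝ) + 1) * ‖1 - ch (μ n) (lin (Pi.single j t))‖ ≤ ε / 2 := by
    have h1 : ‖ψ (Pi.single j t)‖ ≤ ε' := by
      have := hδψ (x := Pi.single j t) (by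
        rw [dist_zero_right, pi_norm_lt_iff hδ]
        intro i
        rcases eq_or_ne i j with rfl | hij
        · simpa using ht
        · simpa [hij] using hδ)
      rw [hψ0, dist_zero_right] at this
      exact this.le
    rw [h]
    calc _ ≤ 2 * ‖ψ (Pi.single j t)‖ :=
          mul_norm_one_sub_exp_div_le n (h1.trans (min_le_left _ _))
      _ ≤ 2 * (ε / 4) := by gcongr; exact h1.trans (min_le_right _ _)
      _ = ε / 2 := by ring
  -- With r = 4/δ the frequencies needed below, up to 2/r = δ/2 and at 1/r = δ/4, lie within the
  -- range δ where ψ is small.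
  have hr : 0 < 4 / δ := by positivity
  have htail (n : ℕ) (j : ι) : ((n : ℝ) + 1) * (μ n).real {x | 4 / δ < |x j|} ≤ ε := by
    have hn0 : (0 : ℝ) < (n : ℝ) + 1 := by positivity
    have := measureReal_abs_eval_gt_le (μ n) j (ε := ε / 2 / ((n : ℝ) + 1)) hr fun t ht => by
      rw [le_div_iff₀ hn0, mul_comm]
      refine hsmall n j t (ht.trans_lt ?_)
      rw [div_div_eq_mul_div, div_lt_iff₀ (by norm_num)]
      linarith
    calc _ ≤ ((n : ℝ) + 1) * (2 * (ε / 2 / ((n : ℝ) + 1))) := by gcongr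
      _ = ε := by field_simp
  refine ⟨4 / δ, hr, fun (n : ℕ) j => ⟨htail n j, ?_⟩⟩
  have hn0 : (0 : ℝ) < (n : ℝ) + 1 := by positivity
  have h1 := integral_min_one_sq_le (μ n) j hr
  have h2 := hsmall n j (1 / (4 / δ)) (by
    rw [one_div_div, abs_of_pos (by positivity)]
    linarith)
  calc _ ≤ ((n : ℝ) + 1) * ((μ n).real {x | 4 / δ < |x j|} + 5 * (4 / δ) ^ 2 *
        ‖1 - ch (μ n) (lin (Pi.single j (1 / (4 / δ))))‖) := by gcongr
    _ = ((n : ℝ) + 1) * (μ n).real {x | 4 / δ < |x j|} + 5 * (4 / δ) ^ 2 *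
        (((n : ℝ) + 1) * ‖1 - ch (μ n) (lin (Pi.single j (1 / (4 / δ))))‖) := by ring
    _ ≤ ε + 5 * (4 / δ) ^ 2 * ε := by
        gcongr
        · exact htail n j
        · linarith

/-- The function whose integral against `levyWeight • ν` gives the Lévy exponent up to the quadratic
compensation; it is continuous, also at the origin. -/
def compensatedQuotient (θ x : ι → ℝ) : ℂ :=
  (levyIntegrand θ x + ((lin θ (levyVec x) ^ 2 / 2 : ℝ) : ℂ)) / (levyWeight x : ℂ)

theorem levyWeight_smul_compensatedQuotient (θ x : ι → ℝ) :
    levyWeight x • compensatedQuotient θ x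
      = levyIntegrand θ x + ((lin θ (levyVec x) ^ 2 / 2 : ℝ) : ℂ) := by
  rw [compensatedQuotient, Complex.real_smul]
  -- At the origin the quotient is 0/0 = 0 and both sides vanish.
  by_cases hx : x = 0
  · subst hx
    have : levyVec (0 : ι → ℝ) = 0 := levyVec_of_norm_le (by simp)
    simp [levyWeight_zero, levyIntegrand, this, lin]
  · have := (levyWeight_pos hx).ne'
    rw [mul_div_cancel₀]
    exact_mod_cast this

theorem norm_compensatedQuotient_le_of_norm_le (θ : ι → ℝ) {x : ι → ℝ} (h : ‖x‖ ≤ 1) :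
    ‖compensatedQuotient θ x‖ ≤ (∑ j, |θ j|) ^ 3 * Real.exp (∑ j, |θ j|) * ‖x‖ := by
  set T := ∑ j, |θ j|
  have hT0 : 0 ≤ T := Finset.sum_nonneg fun _ _ => abs_nonneg _
  rcases eq_or_ne x 0 with rfl | hx
  · simp [compensatedQuotient, levyWeight_zero]
  have hw : levyWeight x = ‖x‖ ^ 2 := min_eq_right (pow_le_one₀ (norm_nonneg _) h)
  have hxpos : 0 < ‖x‖ := norm_pos_iff.2 hx
  have hy : |lin θ x| ≤ T * ‖x‖ := abs_lin_le θ x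
  have hy1 : |lin θ x| ≤ T := hy.trans (mul_le_of_le_one_right hT0 h)
  rw [compensatedQuotient, levyIntegrand, levyVec_of_norm_le h, norm_div, Complex.norm_real,
    hw, norm_pow, norm_norm, div_le_iff₀ (by positivity)]
  calc _ ≤ |lin θ x| ^ 3 * Real.exp |lin θ x| := norm_exp_I_mul_sub_add_le _
    _ ≤ (T * ‖x‖) ^ 3 * Real.exp T := by gcongr
    _ = _ := by ring

theorem exists_norm_compensatedQuotient_le (θ : ι → ℝ) :
    ∃ C, ∀ x, ‖compensatedQuotient θ x‖ ≤ C := by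
  set T := ∑ j, |θ j|
  have hT0 : 0 ≤ T := Finset.sum_nonneg fun _ _ => abs_nonneg _
  refine ⟨T ^ 3 * Real.exp T + (2 + T + T ^ 2 * Real.exp T + T ^ 2), fun x => ?_⟩
  rcases le_total ‖x‖ 1 with h | h
  · refine (norm_compensatedQuotient_le_of_norm_le θ h).trans ?_
    refine (mul_le_of_le_one_right (by positivity) h).trans ?_
    exact le_add_of_nonneg_right (by positivity)
  · have hw : levyWeight x = 1 := min_eq_left (one_le_pow₀ h)
    have h1 := norm_levyIntegrand_le θ x le_rfl
    rw [hw, mul_one] at h1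
    have h2 : ‖((lin θ (levyVec x) ^ 2 / 2 : ℝ) : ℂ)‖ ≤ T ^ 2 := by
      rw [Complex.norm_real, Real.norm_eq_abs, abs_of_nonneg (by positivity), ← sq_abs]
      have := pow_le_pow_left₀ (abs_nonneg _) (abs_lin_levyVec_le θ x) 2
      nlinarith [sq_nonneg |lin θ (levyVec x)|]
    rw [compensatedQuotient, hw, Complex.ofReal_one, div_one]
    refine (norm_add_le _ _).trans ((add_le_add h1 h2).trans ?_)
    exact le_add_of_nonneg_left (by positivity)

/-- Adding the quadratic term cancels the Taylor expansion to second order, so near the origin a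
cubic remainder is divided by ‖x‖². The quotient tends to 0, which is also the value of 0/0. -/
theorem continuous_compensatedQuotient (θ : ι → ℝ) : Continuous (compensatedQuotient θ) := by
  refine continuous_iff_continuousAt.2 fun x => ?_
  rcases eq_or_ne x 0 with rfl | hx
  · have h0 : compensatedQuotient θ 0 = 0 := by simp [compensatedQuotient, levyWeight_zero]
    rw [ContinuousAt, h0]
    refine squeeze_zero_norm' (a := fun x : ι → ℝ =>
      (∑ j, |θ j|) ^ 3 * Real.exp (∑ j, |θ j|) * ‖x‖) ?_ ?_
    · filter_upwards [Metric.closedBall_mem_nhds (0 : ι → ℝ) one_pos] with x hx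
      exact norm_compensatedQuotient_le_of_norm_le θ (by simpa using hx)
    · have : Continuous fun x : ι → ℝ => (∑ j, |θ j|) ^ 3 * Real.exp (∑ j, |θ j|) * ‖x‖ := by
        fun_prop
      simpa using this.tendsto 0
  · have h1 := (continuous_levyIntegrand θ).continuousAt (x := x)
    have h2 := ((continuous_lin θ).comp (continuous_levyVec (ι := ι))).continuousAt (x := x)
    have h3 := (continuous_levyWeight (ι := ι)).continuousAt (x := x)
    have h4 := (levyWeight_pos hx).ne'
    refine ContinuousAt.div ?_ (Complex.continuous_ofReal.continuousAt.comp h3)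
      (by exact_mod_cast h4)
    refine h1.add (Complex.continuous_ofReal.continuousAt.comp ((h2.pow 2).div_const 2))

end LevyKhintchine

/-! ### Weak limits of weighted roots and the Lévy–Khintchine formula -/

section LevyKhintchine

variable {ι : Type*} [Fintype ι]

/-- The measure with density `levyWeight` with respect to `c • μ`. -/
def weighted (c : ℝ≥0) (μ : Measure (ι → ℝ)) : Measure (ι → ℝ) :=
  (c • μ).withDensity fun x => ENNReal.ofReal (levyWeight x)

theorem measurable_ofReal_levyWeight :
    Measurable fun x : ι → ℝ => ENNReal.ofReal (levyWeight x) :=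
  continuous_levyWeight.measurable.ennreal_ofReal

theorem integral_weighted (c : ℝ≥0) (μ : Measure (ι → ℝ)) {E : Type*} [NormedAddCommGroup E]
    [NormedSpace ℝ E] (f : (ι → ℝ) → E) :
    ∫ x, f x ∂(weighted c μ) = (c : ℝ) • ∫ x, levyWeight x • f x ∂μ := by
  rw [weighted, integral_withDensity_eq_integral_toReal_smul measurable_ofReal_levyWeight
    (ae_of_all _ fun _ => ENNReal.ofReal_lt_top), integral_smul_nnreal_measure]
  simp_rw [ENNReal.toReal_ofReal (levyWeight_nonneg _)]
  rfl

theorem weighted_le (c : ℝ≥0) (μ : Measure (ι → ℝ)) : weighted c μ ≤ c • μ := by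
  calc weighted c μ ≤ (c • μ).withDensity 1 := withDensity_mono (ae_of_all _ fun x => by
        rw [Pi.one_apply, ENNReal.ofReal_le_one]; exact min_le_left _ _)
    _ = c • μ := withDensity_one

instance (c : ℝ≥0) (μ : Measure (ι → ℝ)) [IsFiniteMeasure μ] : IsFiniteMeasure (weighted c μ) :=
  isFiniteMeasure_of_le _ (weighted_le c μ)

theorem weighted_real_univ (c : ℝ≥0) (μ : Measure (ι → ℝ)) :
    (weighted c μ).real Set.univ = c * ∫ x, levyWeight x ∂μ := by
  have := integral_weighted c μ fun _ => (1 : ℝ)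
  simpa using this

variable {μ : ℕ → Measure (ι → ℝ)} [∀ n, IsProbabilityMeasure (μ n)] {ψ : (ι → ℝ) → ℂ}

/-- The weighted measures `levyWeight • (n + 1) μₙ` converge along an ultrafilter. -/
theorem exists_tendsto_weighted (hψ : ContinuousAt ψ 0) (hψ0 : ψ 0 = 0)
    (h : ∀ n θ, ch (μ n) (lin θ) = Complex.exp (ψ θ / ((n : ℂ) + 1))) :
    ∃ (C : ℝ) (ρ : Measure (ι → ℝ)), IsFiniteMeasure ρ ∧
      (∀ n : ℕ, ((n : ℝ) + 1) * ∫ x, levyWeight x ∂(μ n) ≤ C) ∧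
      ∀ f : (ι → ℝ) → ℂ, Continuous f → (∃ B, ∀ x, ‖f x‖ ≤ B) →
        Tendsto (fun n : ℕ => ((n : ℂ) + 1) * ∫ x, levyWeight x • f x ∂(μ n))
          (hyperfilter ℕ : Filter ℕ) (𝓝 (∫ x, f x ∂ρ)) := by
  set d : ℝ := (Fintype.card ι : ℝ)
  have hd : 0 ≤ d := by positivity
  obtain ⟨r, hr, hr'⟩ := exists_uniform_tail_bound hψ hψ0 h one_pos
  have hmint n (j : ι) : Integrable (fun x : ι → ℝ => min 1 (x j ^ 2)) (μ n) :=
    Integrable.of_bound (C := 1) (Continuous.aestronglyMeasurable (by fun_prop))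
      (ae_of_all _ fun x => by
        rw [Real.norm_eq_abs, abs_of_nonneg (by positivity)]
        exact min_le_left _ _)
  set C : ℝ := d * (1 + 5 * r ^ 2 * 1)
  have hC (n : ℕ) : ((n : ℝ) + 1) * ∫ x, levyWeight x ∂(μ n) ≤ C := by
    calc ((n : ℝ) + 1) * ∫ x, levyWeight x ∂(μ n)
        ≤ ((n : ℝ) + 1) * ∫ x, ∑ j, min 1 (x j ^ 2) ∂(μ n) := by
          refine mul_le_mul_of_nonneg_left ?_ (by positivity)
          refine integral_mono_of_nonneg (ae_of_all _ levyWeight_nonneg)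
            (integrable_finsetSum _ fun j _ => hmint n j) (ae_of_all _ levyWeight_le_sum)
      _ = ∑ j, ((n : ℝ) + 1) * ∫ x, min 1 (x j ^ 2) ∂(μ n) := by
          rw [integral_finsetSum _ fun j _ => hmint n j, Finset.mul_sum]
      _ ≤ ∑ _j : ι, (1 + 5 * r ^ 2 * 1) := Finset.sum_le_sum fun j _ => (hr' n j).2
      _ = C := by simp only [C, d, Finset.sum_const, Finset.card_univ, nsmul_eq_mul]
  have htail (k : ℕ) : ∃ R : ℝ, 0 < R ∧ ∀ n : ℕ,
      ((n : ℝ) + 1) * (μ n).real (Metric.closedBall 0 R)ᶜ ≤ 1 / ((k : ℝ) + 1) := by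
    -- The tolerance is shared among the d coordinates; d + 1 keeps the denominator nonzero when
    -- there are none.
    obtain ⟨R, hR, hR'⟩ := exists_uniform_tail_bound hψ hψ0 h
      (show 0 < 1 / ((d + 1) * ((k : ℝ) + 1)) by positivity)
    refine ⟨R, hR, fun n => ?_⟩
    have hsub : (Metric.closedBall (0 : ι → ℝ) R)ᶜ ⊆ ⋃ j, {x | R < |x j|} := by
      intro x hx
      by_contra hcon
      simp only [Set.mem_iUnion, not_exists, Set.mem_ofPred_eq, not_lt] at hcon
      exact hx (by rw [mem_closedBall_zero_iff]
                   exact (pi_norm_le_iff_of_nonneg hR.le).2 hcon)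
    calc ((n : ℝ) + 1) * (μ n).real (Metric.closedBall 0 R)ᶜ
        ≤ ((n : ℝ) + 1) * ∑ j, (μ n).real {x | R < |x j|} := by
          gcongr
          exact (measureReal_mono hsub).trans (measureReal_iUnion_fintype_le _)
      _ = ∑ j, ((n : ℝ) + 1) * (μ n).real {x | R < |x j|} := by rw [Finset.mul_sum]
      _ ≤ ∑ _j : ι, 1 / ((d + 1) * ((k : ℝ) + 1)) := Finset.sum_le_sum fun j _ => (hR' n j).1
      _ = d / (d + 1) * (1 / ((k : ℝ) + 1)) := by simp [d]; field_simp
      _ ≤ 1 / ((k : ℝ) + 1) := by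
          refine mul_le_of_le_one_left (by positivity) ?_
          rw [div_le_one (by positivity)]; linarith
  choose R hR htail using htail
  set ρ : ℕ → FiniteMeasure (ι → ℝ) := fun n => ⟨weighted (n + 1) (μ n), inferInstance⟩
  have hρreal n s : ((ρ n s : ℝ≥0) : ℝ) = (weighted (n + 1) (μ n)).real s := rfl
  have hu : Tendsto (fun k : ℕ => Real.toNNReal (1 / ((k : ℝ) + 1))) atTop (𝓝 0) := by
    rw [← Real.toNNReal_zero]
    exact (continuous_real_toNNReal.tendsto 0).comp tendsto_one_div_add_atTop_nhds_zero_nat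
  -- Prokhorov compactness for finite measures: masses at most C, and uniformly small mass outside
  -- the balls of radius `R k`.
  have hcomp := isCompact_setOfPred_finiteMeasure_mass_le_compl_isCompact_le (E := ι → ℝ)
    (C := Real.toNNReal C) hu (fun k => isCompact_closedBall (0 : ι → ℝ) (R k))
    (Or.inl inferInstance)
  obtain ⟨ρ', -, hρ'⟩ := hcomp.ultrafilter_le_nhds ((hyperfilter ℕ).map ρ) (by
    rw [Ultrafilter.coe_map, le_principal_iff, mem_map]
    refine Eventually.of_forall fun n => ⟨?_, fun k => ?_⟩
    · refine NNReal.le_toNNReal_of_coe_le ?_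
      rw [FiniteMeasure.mass, hρreal, weighted_real_univ]
      push_cast
      exact hC n
    · refine NNReal.le_toNNReal_of_coe_le ?_
      rw [hρreal]
      refine le_trans ?_ (htail k n)
      calc (weighted (n + 1) (μ n)).real (Metric.closedBall 0 (R k))ᶜ
          ≤ (((n : ℝ≥0) + 1) • μ n).real (Metric.closedBall 0 (R k))ᶜ :=
            ENNReal.toReal_mono (measure_ne_top _ _) (weighted_le _ _ _)
        _ = ((n : ℝ) + 1) * (μ n).real (Metric.closedBall 0 (R k))ᶜ := by
            rw [measureReal_nnreal_smul_apply]; push_cast; rfl)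
  have hρ'' : Tendsto ρ (hyperfilter ℕ : Filter ℕ) (𝓝 ρ') := hρ'
  rw [FiniteMeasure.tendsto_iff_forall_integral_rclike_tendsto ℂ] at hρ''
  refine ⟨C, ρ', inferInstance, hC, fun f hf ⟨B, hB⟩ => ?_⟩
  refine (hρ'' (BoundedContinuousFunction.ofNormedAddCommGroup f hf B hB)).congr fun n => ?_
  change ∫ x, f x ∂(weighted (n + 1) (μ n)) = _
  rw [integral_weighted, Complex.real_smul]
  push_cast
  rfl

theorem integrable_levyFun_mul {ν : Measure (ι → ℝ)} (hν : Integrable levyWeight ν) (j k : ι) :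
    Integrable (fun x : ι → ℝ => levyFun (x j) * levyFun (x k)) ν :=
  hν.mono' (by
    have h1 := continuous_levyFun.comp (continuous_apply (A := fun _ : ι => ℝ) j)
    have h2 := continuous_levyFun.comp (continuous_apply (A := fun _ : ι => ℝ) k)
    exact (h1.mul h2).aestronglyMeasurable) (ae_of_all _ fun x => abs_levyFun_mul_le x j k)

theorem lin_levyVec_sq (θ x : ι → ℝ) :
    lin θ (levyVec x) ^ 2 = ∑ j, ∑ k, θ j * (levyFun (x j) * levyFun (x k)) * θ k := by
  rw [sq, lin, Finset.sum_mul_sum]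
  refine Finset.sum_congr rfl fun j _ => Finset.sum_congr rfl fun k _ => ?_
  simp only [levyVec]; ring

theorem integral_lin_levyVec_sq {ν : Measure (ι → ℝ)} (hν : Integrable levyWeight ν)
    (θ : ι → ℝ) :
    ∫ x, lin θ (levyVec x) ^ 2 ∂ν
      = ∑ j, ∑ k, θ j * (∫ x, levyFun (x j) * levyFun (x k) ∂ν) * θ k := by
  simp_rw [lin_levyVec_sq]
  rw [integral_finsetSum _ fun j _ => integrable_finsetSum _ fun k _ =>
    ((integrable_levyFun_mul hν j k).const_mul _).mul_const _]
  refine Finset.sum_congr rfl fun j _ => ?_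
  rw [integral_finsetSum _ fun k _ =>
    ((integrable_levyFun_mul hν j k).const_mul _).mul_const _]
  refine Finset.sum_congr rfl fun k _ => ?_
  rw [integral_mul_const, integral_const_mul]

theorem integrable_lin_levyVec_sq {ν : Measure (ι → ℝ)} (hν : Integrable levyWeight ν)
    (θ : ι → ℝ) : Integrable (fun x => lin θ (levyVec x) ^ 2) ν := by
  simp_rw [lin_levyVec_sq]
  exact integrable_finsetSum _ fun j _ => integrable_finsetSum _ fun k _ =>
    ((integrable_levyFun_mul hν j k).const_mul _).mul_const _

theorem integrable_complex_ofReal {Ω : Type*} [MeasurableSpace Ω] {P : Measure Ω} {f : Ω → ℝ}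
    (hf : Integrable f P) : Integrable (fun x => (f x : ℂ)) P :=
  hf.ofReal

theorem dotProduct_mulVec_eq_sum (A : Matrix ι ι ℝ) (θ : ι → ℝ) :
    θ ⬝ᵥ A.mulVec θ = ∑ j, ∑ k, θ j * A j k * θ k := by
  simp only [dotProduct, Matrix.mulVec, Finset.mul_sum, mul_assoc]

/-- The Lévy measure obtained from a finite measure by dividing by `levyWeight`. -/
def unweighted (ρ : Measure (ι → ℝ)) : Measure (ι → ℝ) :=
  (ρ.restrict {0}ᶜ).withDensity fun x => ENNReal.ofReal (levyWeight x)⁻¹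

theorem measurable_ofReal_levyWeight_inv :
    Measurable fun x : ι → ℝ => ENNReal.ofReal (levyWeight x)⁻¹ :=
  continuous_levyWeight.measurable.inv.ennreal_ofReal

theorem unweighted_zero (ρ : Measure (ι → ℝ)) : unweighted ρ {0} = 0 := by
  rw [unweighted, withDensity_apply _ (measurableSet_singleton _),
    Measure.restrict_restrict (measurableSet_singleton _)]
  simp

theorem lintegral_unweighted (ρ : Measure (ι → ℝ)) [IsFiniteMeasure ρ] :
    ∫⁻ x, ENNReal.ofReal (min 1 (‖x‖ ^ 2)) ∂(unweighted ρ) < ∞ := by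
  change ∫⁻ x, ENNReal.ofReal (levyWeight x) ∂(unweighted ρ) < ∞
  rw [unweighted, lintegral_withDensity_eq_lintegral_mul _ measurable_ofReal_levyWeight_inv
    measurable_ofReal_levyWeight]
  calc _ ≤ ∫⁻ _, 1 ∂(ρ.restrict {0}ᶜ) := by
        refine lintegral_mono fun x => ?_
        rw [Pi.mul_apply, ← ENNReal.ofReal_mul (inv_nonneg.2 (levyWeight_nonneg x)),
          ENNReal.ofReal_le_one]
        exact inv_mul_le_one
    _ < ∞ := by simp

/-- Dividing by the weight loses any atom of ρ at 0, and `f 0 = 0` makes this loss invisible. -/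
theorem integral_unweighted (ρ : Measure (ι → ℝ)) {f : (ι → ℝ) → ℂ} (hf : f 0 = 0) :
    ∫ x, levyWeight x • f x ∂(unweighted ρ) = ∫ x, f x ∂ρ := by
  rw [unweighted, integral_withDensity_eq_integral_toReal_smul measurable_ofReal_levyWeight_inv
    (ae_of_all _ fun _ => ENNReal.ofReal_lt_top)]
  have hs : MeasurableSet ({0}ᶜ : Set (ι → ℝ)) := (measurableSet_singleton _).compl
  rw [setIntegral_congr_fun (g := f) hs fun x hx => by
    have := (levyWeight_pos hx).ne'
    rw [ENNReal.toReal_ofReal (inv_nonneg.2 (levyWeight_nonneg x)), smul_smul,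
      inv_mul_cancel₀ this, one_smul]]
  refine setIntegral_eq_integral_of_forall_compl_eq_zero fun x hx => ?_
  rw [Set.mem_compl_iff, not_not, Set.mem_singleton_iff] at hx
  rw [hx, hf]

/-- The **Lévy–Khintchine formula** for a law all of whose convolution roots are given. -/
theorem exists_levyExponent (hψ : ContinuousAt ψ 0) (hψ0 : ψ 0 = 0)
    (h : ∀ n θ, ch (μ n) (lin θ) = Complex.exp (ψ θ / ((n : ℂ) + 1))) :
    ∃ (b : ι → ℝ) (A : Matrix ι ι ℝ) (ν : Measure (ι → ℝ)), A.PosSemidef ∧ ν {0} = 0 ∧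
      ∫⁻ x, ENNReal.ofReal (min 1 (‖x‖ ^ 2)) ∂ν < ∞ ∧ ∀ θ, ψ θ = levyExponent b A ν θ := by
  classical
  obtain ⟨C, ρ, hρ, hC, hlim⟩ := exists_tendsto_weighted hψ hψ0 h
  have hw n : Integrable levyWeight (μ n) :=
    Integrable.of_bound (C := 1) continuous_levyWeight.aestronglyMeasurable
      (ae_of_all _ fun x => by
        rw [Real.norm_eq_abs, abs_of_nonneg (levyWeight_nonneg x)]
        exact min_le_left _ _)
  -- second moments of the truncated jumps
  set M' : ℕ → ι → ι → ℝ := fun n j k =>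
    ((n : ℝ) + 1) * ∫ x, levyFun (x j) * levyFun (x k) ∂(μ n)
  -- Each second moment is dominated by the integral of `levyWeight`, hence stays in [-C, C] and
  -- converges along the ultrafilter.
  have hM (j k : ι) : ∃ m : ℝ, Tendsto (fun n => M' n j k) (hyperfilter ℕ : Filter ℕ) (𝓝 m) := by
    obtain ⟨m, -, hm⟩ := (isCompact_Icc (a := -C) (b := C)).ultrafilter_le_nhds
      ((hyperfilter ℕ).map fun n => M' n j k) (by
        rw [Ultrafilter.coe_map, le_principal_iff, mem_map]
        refine Eventually.of_forall fun n => ?_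
        change M' n j k ∈ Set.Icc (-C) C
        rw [Set.mem_Icc, ← abs_le]
        refine le_trans ?_ (hC n)
        rw [abs_mul, abs_of_pos (by positivity)]
        gcongr
        exact norm_integral_le_of_norm_le (f := fun x : ι → ℝ => levyFun (x j) * levyFun (x k))
          (hw n) (ae_of_all _ fun x => abs_levyFun_mul_le x j k))
    exact ⟨m, hm⟩
  choose M hM using hM
  have hMsymm (j k : ι) : M j k = M k j := by
    refine tendsto_nhds_unique (hM j k) ((hM k j).congr fun n => ?_)
    simp only [M', mul_comm]
  set q' : ℕ → (ι → ℝ) → ℝ := fun n θ => ∑ j, ∑ k, θ j * M' n j k * θ k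
  set q : (ι → ℝ) → ℝ := fun θ => ∑ j, ∑ k, θ j * M j k * θ k
  have hq (θ : ι → ℝ) : Tendsto (fun n => q' n θ) (hyperfilter ℕ : Filter ℕ) (𝓝 (q θ)) :=
    tendsto_finsetSum _ fun j _ => tendsto_finsetSum _ fun k _ =>
      ((hM j k).const_mul _).mul_const _
  -- drifts
  set b' : ℕ → ι → ℝ := fun n j => ((n : ℝ) + 1) * ∫ x, levyFun (x j) ∂(μ n)
  have hLint n (j : ι) : Integrable (fun x : ι → ℝ => levyFun (x j)) (μ n) :=
    Integrable.of_bound (C := 1)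
      (continuous_levyFun.comp (continuous_apply j)).aestronglyMeasurable
      (ae_of_all _ fun x => abs_levyFun_le_one _)
  have hlinint n θ : Integrable (fun x => lin θ (levyVec x)) (μ n) :=
    integrable_finsetSum _ fun j _ => (hLint n j).const_mul _
  have hlin n θ : lin θ (b' n) = ((n : ℝ) + 1) * ∫ x, lin θ (levyVec x) ∂(μ n) := by
    simp only [lin, b', levyVec]
    rw [integral_finsetSum _ fun j _ => (hLint n j).const_mul _, Finset.mul_sum]
    refine Finset.sum_congr rfl fun j _ => ?_
    rw [integral_const_mul]; ring
  have hid (n : ℕ) (θ : ι → ℝ) :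
      ((n : ℂ) + 1) * ∫ x, levyWeight x • compensatedQuotient θ x ∂(μ n)
        = ((n : ℂ) + 1) * (Complex.exp (ψ θ / ((n : ℂ) + 1)) - 1)
          - Complex.I * (lin θ (b' n) : ℂ) + ((q' n θ / 2 : ℝ) : ℂ) := by
    simp_rw [levyWeight_smul_compensatedQuotient]
    have hexp := integrable_exp_I_mul (P := μ n) (measurable_lin θ).aemeasurable
    have hsq := integrable_lin_levyVec_sq (hw n) θ
    have h1 : ∫ x, levyIntegrand θ x ∂(μ n) = (Complex.exp (ψ θ / ((n : ℂ) + 1)) - 1)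
        - Complex.I * ((∫ x, lin θ (levyVec x) ∂(μ n) : ℝ) : ℂ) := by
      unfold levyIntegrand
      have hexp1 : Integrable (fun x => Complex.exp (Complex.I * (lin θ x : ℂ)) - 1) (μ n) :=
        hexp.sub (integrable_const _)
      rw [integral_sub hexp1 ((integrable_complex_ofReal (hlinint n θ)).const_mul _),
        integral_sub hexp (integrable_const _), integral_const_mul, integral_complex_ofReal,
        ← h n θ]
      simp [ch]
    have h2 : q' n θ = ((n : ℝ) + 1) * ∫ x, lin θ (levyVec x) ^ 2 ∂(μ n) := by
      rw [integral_lin_levyVec_sq (hw n)]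
      simp only [q', M', Finset.mul_sum]
      refine Finset.sum_congr rfl fun j _ => Finset.sum_congr rfl fun k _ => by ring
    rw [integral_add (integrable_levyIntegrand (hw n) θ)
      (integrable_complex_ofReal (hsq.div_const 2)),
      integral_complex_ofReal, integral_div, h1, h2, hlin]
    push_cast
    ring
  have hbasic (θ : ι → ℝ) : Tendsto (fun n => Complex.I * (lin θ (b' n) : ℂ))
      (hyperfilter ℕ : Filter ℕ)
      (𝓝 (ψ θ + ((q θ / 2 : ℝ) : ℂ) - ∫ x, compensatedQuotient θ x ∂ρ)) := by
    have t1 := hlim _ (continuous_compensatedQuotient θ) (exists_norm_compensatedQuotient_le θ)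
    have t2 := (tendsto_mul_exp_div_sub_one (ψ θ)).mono_left Nat.hyperfilter_le_atTop
    have t3 := (Complex.continuous_ofReal.tendsto _).comp ((hq θ).div_const 2)
    refine ((t2.add t3).sub t1).congr fun n => ?_
    rw [hid]
    simp only [Function.comp_def]
    ring
  -- No a priori bound on the drifts is needed: every other term of the identity `hid` converges, so
  -- the drift term does too, and testing with a basis vector isolates one coordinate.
  have hb (j : ι) : ∃ β : ℝ, Tendsto (fun n => b' n j) (hyperfilter ℕ : Filter ℕ) (𝓝 β) := by
    have := (Complex.continuous_im.tendsto _).comp (hbasic (Pi.single j 1))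
    refine ⟨_, this.congr fun n => ?_⟩
    simp [lin_single]
  choose b hb using hb
  have hmain (θ : ι → ℝ) : ψ θ = Complex.I * (lin θ b : ℂ) - ((q θ / 2 : ℝ) : ℂ)
      + ∫ x, compensatedQuotient θ x ∂ρ := by
    have t : Tendsto (fun n => Complex.I * (lin θ (b' n) : ℂ)) (hyperfilter ℕ : Filter ℕ)
        (𝓝 (Complex.I * (lin θ b : ℂ))) := by
      refine (((Complex.continuous_ofReal.tendsto _).comp ?_).const_mul _)
      exact tendsto_finsetSum _ fun j _ => (hb j).const_mul _
    have := tendsto_nhds_unique t (hbasic θ)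
    rw [this]; ring
  set ν := unweighted ρ
  have hνw : Integrable levyWeight ν := integrable_levyWeight (lintegral_unweighted ρ)
  have hcomp (θ : ι → ℝ) : ∫ x, compensatedQuotient θ x ∂ρ
      = ∫ x, levyIntegrand θ x ∂ν + (((∫ x, lin θ (levyVec x) ^ 2 ∂ν) / 2 : ℝ) : ℂ) := by
    rw [← integral_unweighted ρ (by simp [compensatedQuotient, levyWeight_zero])]
    simp_rw [levyWeight_smul_compensatedQuotient]
    rw [integral_add (integrable_levyIntegrand hνw θ)
      (integrable_complex_ofReal ((integrable_lin_levyVec_sq hνw θ).div_const 2)), integral_complex_ofReal,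
      integral_div]
  -- The Gaussian matrix is the part of the limiting second moments not accounted for by the jumps
  -- in ν.
  set A : Matrix ι ι ℝ :=
    Matrix.of fun j k => M j k - ∫ x, levyFun (x j) * levyFun (x k) ∂ν
  have hA (θ : ι → ℝ) : ∑ j, ∑ k, θ j * A j k * θ k
      = q θ - ∫ x, lin θ (levyVec x) ^ 2 ∂ν := by
    rw [integral_lin_levyVec_sq hνw]
    simp only [q, A, Matrix.of_apply, mul_sub, sub_mul, Finset.sum_sub_distrib]
  have hfinal (θ : ι → ℝ) : ψ θ = levyExponent b A ν θ := by
    rw [hmain, hcomp, levyExponent, hA]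
    push_cast
    ring
  refine ⟨b, A, ν, ?_, unweighted_zero ρ, lintegral_unweighted ρ, hfinal⟩
  refine Matrix.PosSemidef.of_dotProduct_mulVec_nonneg ?_ fun θ => ?_
  · ext j k
    simp only [Matrix.conjTranspose_apply, star_trivial, A, Matrix.of_apply]
    rw [hMsymm k j]
    simp_rw [mul_comm]
  -- Positivity is read off at infinity: |φ| ≤ 1 gives Re ψ ≤ 0, and the quadratic form is the limit
  -- of -2 Re ψ(rθ) / r².
  · have hre (θ : ι → ℝ) : (ψ θ).re ≤ 0 := by
      have h1 := norm_ch_le_one (μ 0) (lin θ)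
      rw [h 0 θ, Complex.norm_exp] at h1
      simpa using h1
    have ht := tendsto_re_levyExponent_div_sq hνw b A θ
    have hnonneg : 0 ≤ ∑ j, ∑ k, θ j * A j k * θ k := by
      refine ge_of_tendsto' ht fun r => ?_
      rw [← hfinal]
      have := hre (r • θ)
      exact div_nonneg (by linarith) (sq_nonneg r)
    rw [star_trivial, dotProduct_mulVec_eq_sum]
    exact hnonneg

end LevyKhintchine

/-! ### Consistent roots through the logarithm -/

section Roots

/-- A family `f s` of complex numbers with `f (n s) = f(s)ⁿ` which is close to `1` for small `s`
has the form `f (1 / n) = exp (z / n)`. -/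
theorem exists_eq_exp_div {f : ℝ≥0 → ℂ} (hf : ∀ (n : ℕ) (s : ℝ≥0), 1 ≤ n → f (n * s) = f s ^ n)
    {N : ℕ} (hN : 1 ≤ N) (hnear : ∀ s : ℝ≥0, s ≤ 1 / N → ‖f s - 1‖ < 1) (n : ℕ) (hn : 1 ≤ n) :
    f (1 / n) = Complex.exp ((N : ℂ) * Complex.log (f (1 / N)) / n) := by
  have hN0 : (N : ℂ) ≠ 0 := by exact_mod_cast (by lia : N ≠ 0)
  have hn0 : (n : ℂ) ≠ 0 := by exact_mod_cast (by lia : n ≠ 0)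
  have hN0' : (N : ℝ≥0) ≠ 0 := by exact_mod_cast (by lia : N ≠ 0)
  have hn0' : (n : ℝ≥0) ≠ 0 := by exact_mod_cast (by lia : n ≠ 0)
  have hre (s : ℝ≥0) (hs : s ≤ 1 / N) : 0 < (f s).re := by
    have h1 := (Complex.abs_re_le_norm (f s - 1)).trans_lt (hnear s hs)
    rw [Complex.sub_re, Complex.one_re, abs_lt] at h1
    linarith
  have hne (s : ℝ≥0) (hs : s ≤ 1 / N) : f s ≠ 0 := fun h => by
    have := hre s hs
    simp [h] at this
  -- A common refinement of the two scales: 1/N = n s and 1/n = N s.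
  set s : ℝ≥0 := 1 / (n * N)
  have hks (k : ℕ) (hk : k ≤ n) : (k : ℝ≥0) * s ≤ 1 / N := by
    have : (n : ℝ≥0) * s = 1 / N := by simp only [s]; field_simp
    rw [← this]
    gcongr
  -- All the points k s stay below 1/N, where f has positive real part; two arguments below π/2 in
  -- modulus add without leaving the principal branch.
  have hlog (k : ℕ) (hk1 : 1 ≤ k) (hk : k ≤ n) :
      Complex.log (f (k * s)) = k * Complex.log (f s) := by
    induction k, hk1 using Nat.le_induction with
    | base => simp
    | succ k hk1 ih =>
      have ih' := ih (by lia)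
      have hmul : f ((k + 1 : ℕ) * s) = f (k * s) * f s := by
        rw [hf (k + 1) s (by lia), hf k s hk1, pow_succ]
      have hs1 : s ≤ 1 / N := by simpa using hks 1 hn
      have a1 := Complex.abs_arg_lt_pi_div_two_iff.2 (Or.inl (hre _ (hks k (by lia))))
      have a2 := Complex.abs_arg_lt_pi_div_two_iff.2 (Or.inl (hre _ hs1))
      rw [abs_lt] at a1 a2
      rw [hmul, Complex.log_mul (hne _ (hks k (by lia))) (hne _ hs1)
        ⟨by linarith, by linarith⟩, ih']
      push_cast
      ring
  have h1 : Complex.log (f (1 / N)) = n * Complex.log (f s) := by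
    rw [← hlog n hn le_rfl]
    congr 2
    simp only [s]; field_simp
  have h2 : f (1 / n) = f s ^ N := by
    rw [← hf N s hN]
    congr 1
    simp only [s]; field_simp
  have hs1 : s ≤ 1 / N := by simpa using hks 1 hn
  rw [h1, h2, show (N : ℂ) * (n * Complex.log (f s)) / n = N * Complex.log (f s) by field_simp,
    Complex.exp_nat_mul, Complex.exp_log (hne s hs1)]

end Roots

/-! ### Characteristic functions along families of times -/

section Continuity

variable {Ω Ω' : Type*} [MeasurableSpace Ω] [MeasurableSpace Ω']

/-- Agreement of finite-dimensional distributions along finite subsets of the time axis gives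
agreement along arbitrary finite families of times. -/
theorem EqFDD.identDistrib {X : ℝ≥0 → Ω → ℝ} {P : Measure Ω} {Y : ℝ≥0 → Ω' → ℝ}
    {P' : Measure Ω'} (h : EqFDD X P Y P') {ι : Type*} [Fintype ι] (τ : ι → ℝ≥0) :
    IdentDistrib (fun ω i => X (τ i) ω) (fun ω i => Y (τ i) ω) P P' := by
  classical
  have hm : Measurable fun (x : (Finset.univ.image τ) → ℝ) (i : ι) =>
      x ⟨τ i, Finset.mem_image_of_mem τ (Finset.mem_univ i)⟩ := by fun_prop
  exact (h (Finset.univ.image τ)).comp hm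

theorem EqFDD.ch_eq {X : ℝ≥0 → Ω → ℝ} {P : Measure Ω} {Y : ℝ≥0 → Ω' → ℝ}
    {P' : Measure Ω'} (h : EqFDD X P Y P') {ι : Type*} [Fintype ι] (τ : ι → ℝ≥0) (θ : ι → ℝ) :
    ch P (fun ω => lin θ fun i => X (τ i) ω) = ch P' (fun ω => lin θ fun i => Y (τ i) ω) := by
  have hi := h.identDistrib τ
  rw [← ch_map (X := fun ω i => X (τ i) ω) hi.aemeasurable_fst (measurable_lin θ), hi.map_eq,
    ch_map hi.aemeasurable_snd (measurable_lin θ)]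

/-- The characteristic function of `X` along a finite family of times. -/
def fdch (P : Measure Ω) (X : ℝ≥0 → Ω → ℝ) {ι : Type*} [Fintype ι] (τ : ι → ℝ≥0)
    (θ : ι → ℝ) : ℂ :=
  ch P (fun ω => lin θ fun i => X (τ i) ω)

variable {ι : Type*} [Fintype ι] {P : Measure Ω} {X : ℝ≥0 → Ω → ℝ}

theorem fdch_sumOfCopies [SigmaFinite P] (n : ℕ) (τ : ι → ℝ≥0) (θ : ι → ℝ) :
    fdch (Measure.pi fun _ : Fin n => P) (sumOfCopies X n) τ θ = fdch P X τ θ ^ n := by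
  rw [fdch, fdch, ← ch_pi_sum]
  congr 1 with ω
  simp only [lin, sumOfCopies, Finset.mul_sum]
  exact Finset.sum_comm

theorem measurable_vec {ι : Type*} (hX : ∀ t, Measurable (X t)) (τ : ι → ℝ≥0) :
    Measurable fun ω i => X (τ i) ω :=
  measurable_pi_lambda _ fun i => hX (τ i)

theorem continuous_fdch [IsFiniteMeasure P] (hX : ∀ t, Measurable (X t)) (τ : ι → ℝ≥0) :
    Continuous fun θ => fdch P X τ θ :=
  continuous_ch_lin P (measurable_vec hX τ)

theorem fdch_zero [IsProbabilityMeasure P] (τ : ι → ℝ≥0) : fdch P X τ 0 = 1 := by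
  simp only [fdch, lin_zero, ch_zero]

theorem norm_exp_I_mul_sub_exp_I_mul_le (x y : ℝ) :
    ‖Complex.exp (Complex.I * (x : ℂ)) - Complex.exp (Complex.I * (y : ℂ))‖ ≤ |x - y| := by
  have h1 : Complex.exp (Complex.I * (x : ℂ)) - Complex.exp (Complex.I * (y : ℂ))
      = Complex.exp (Complex.I * (y : ℂ)) *
        (Complex.exp (Complex.I * ((x - y : ℝ) : ℂ)) - 1) := by
    rw [mul_sub, ← Complex.exp_add]
    push_cast
    ring_nf
  rw [h1, norm_mul, norm_exp_I_mul, one_mul]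
  exact Real.norm_exp_I_mul_ofReal_sub_one_le

/-- Quantitative continuity of characteristic functions in probability. -/
theorem norm_ch_lin_sub_le [IsProbabilityMeasure P] {Y Z : Ω → ι → ℝ} (hY : Measurable Y)
    (hZ : Measurable Z) {K ε : ℝ} (hε : 0 ≤ ε) {θ : ι → ℝ} (hθ : ‖θ‖ ≤ K) :
    ‖ch P (fun ω => lin θ (Y ω)) - ch P (fun ω => lin θ (Z ω))‖ ≤
      Fintype.card ι * K * ε + 2 * ∑ j, P.real {ω | ε ≤ dist (Y ω j) (Z ω j)} := by
  have hK : 0 ≤ K := (norm_nonneg _).trans hθ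
  have hset j : MeasurableSet {ω | ε ≤ dist (Y ω j) (Z ω j)} :=
    measurableSet_le measurable_const
      (((measurable_pi_apply j).comp hY).dist ((measurable_pi_apply j).comp hZ))
  have hiY := integrable_exp_I_mul (P := P) ((measurable_lin θ).comp hY).aemeasurable
  have hiZ := integrable_exp_I_mul (P := P) ((measurable_lin θ).comp hZ).aemeasurable
  have hind j : Integrable ({ω | ε ≤ dist (Y ω j) (Z ω j)}.indicator (1 : Ω → ℝ)) P :=
    (integrable_const (1 : ℝ)).indicator (hset j)
  have hind0 j ω : 0 ≤ {ω | ε ≤ dist (Y ω j) (Z ω j)}.indicator (1 : Ω → ℝ) ω :=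
    Set.indicator_nonneg (fun _ _ => zero_le_one) _
  have hsub : ch P (fun ω => lin θ (Y ω)) - ch P (fun ω => lin θ (Z ω))
      = ∫ ω, (Complex.exp (Complex.I * (lin θ (Y ω) : ℂ))
        - Complex.exp (Complex.I * (lin θ (Z ω) : ℂ))) ∂P := (integral_sub hiY hiZ).symm
  rw [hsub]
  calc _ ≤ ∫ ω, (Fintype.card ι * K * ε
        + 2 * ∑ j, {ω | ε ≤ dist (Y ω j) (Z ω j)}.indicator (1 : Ω → ℝ) ω) ∂P := by
        refine norm_integral_le_of_norm_le ((integrable_const _).add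
          ((integrable_finsetSum _ fun j _ => hind j).const_mul _)) (ae_of_all _ fun ω => ?_)
        by_cases hω : ∃ j, ε ≤ dist (Y ω j) (Z ω j)
        · obtain ⟨j, hj⟩ := hω
          have h1 : (1 : ℝ) ≤ ∑ j, {ω | ε ≤ dist (Y ω j) (Z ω j)}.indicator (1 : Ω → ℝ) ω := by
            refine le_trans ?_ (Finset.single_le_sum (fun i _ => hind0 i ω) (Finset.mem_univ j))
            rw [Set.indicator_of_mem (by exact hj), Pi.one_apply]
          have h2 : ‖Complex.exp (Complex.I * (lin θ (Y ω) : ℂ))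
              - Complex.exp (Complex.I * (lin θ (Z ω) : ℂ))‖ ≤ 2 := by
            refine (norm_sub_le _ _).trans ?_
            rw [norm_exp_I_mul, norm_exp_I_mul]; norm_num
          have h3 : 0 ≤ Fintype.card ι * K * ε := by positivity
          linarith
        · push Not at hω
          refine (norm_exp_I_mul_sub_exp_I_mul_le _ _).trans ?_
          have h0 : 0 ≤ ∑ j, {ω | ε ≤ dist (Y ω j) (Z ω j)}.indicator (1 : Ω → ℝ) ω :=
            Finset.sum_nonneg fun j _ => hind0 j ω
          have h1 : |lin θ (Y ω) - lin θ (Z ω)| ≤ Fintype.card ι * K * ε := by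
            rw [lin, lin, ← Finset.sum_sub_distrib]
            calc _ ≤ ∑ j, |θ j * Y ω j - θ j * Z ω j| := Finset.abs_sum_le_sum_abs _ _
              _ ≤ ∑ _j : ι, K * ε := by
                  refine Finset.sum_le_sum fun j _ => ?_
                  rw [← mul_sub, abs_mul]
                  exact mul_le_mul ((norm_le_pi_norm θ j).trans hθ)
                    ((Real.dist_eq _ _).symm.trans_le (hω j).le) (abs_nonneg _) hK
              _ = _ := by simp [mul_assoc]
          linarith
    _ = _ := by
        rw [integral_add (integrable_const _)
          ((integrable_finsetSum _ fun j _ => hind j).const_mul _), integral_const, probReal_univ,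
          one_smul, integral_const_mul, integral_finsetSum _ fun j _ => hind j]
        simp only [integral_indicator_one (hset _)]

/-- Characteristic functions of a stochastically continuous process depend continuously on the
times, locally uniformly in the argument. -/
theorem eventually_norm_fdch_sub_lt [IsProbabilityMeasure P] (hX : ∀ t, Measurable (X t))
    (hc : StochasticallyContinuous X P) {T : Type*} {l : Filter T} {σ : T → ι → ℝ≥0}
    {τ : ι → ℝ≥0} (hσ : ∀ j, Tendsto (fun v => σ v j) l (𝓝 (τ j))) (K : ℝ) {δ : ℝ} (hδ : 0 < δ) :
    ∀ᶠ v in l, ∀ θ : ι → ℝ, ‖θ‖ ≤ K → ‖fdch P X (σ v) θ - fdch P X τ θ‖ < δ := by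
  rcases lt_or_ge K 0 with hK | hK
  · exact Eventually.of_forall fun v θ hθ => absurd ((norm_nonneg θ).trans hθ) (not_le.2 hK)
  set ε : ℝ := δ / (2 * (Fintype.card ι * K + 1))
  have hε : 0 < ε := by positivity
  have hεδ : Fintype.card ι * K * ε < δ := by
    have : Fintype.card ι * K * ε = δ * ((Fintype.card ι * K) / (2 * (Fintype.card ι * K + 1))) := by
      simp only [ε]; ring
    rw [this]
    refine mul_lt_of_lt_one_right hδ ?_
    rw [div_lt_one (by positivity)]
    have : 0 ≤ Fintype.card ι * K := by positivity
    linarith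
  have hlim : Tendsto (fun v => Fintype.card ι * K * ε +
      2 * ∑ j, P.real {ω | ε ≤ dist (X (σ v j) ω) (X (τ j) ω)}) l
      (𝓝 (Fintype.card ι * K * ε + 2 * ∑ _j : ι, (0 : ℝ))) := by
    refine ((tendsto_finsetSum _ fun j _ => ?_).const_mul 2).const_add _
    have h1 := (tendstoInMeasure_iff_dist.1 (hc (τ j))) ε hε
    exact (ENNReal.tendsto_toReal ENNReal.zero_ne_top).comp (h1.comp (hσ j))
  rw [Finset.sum_const_zero, mul_zero, add_zero] at hlim
  filter_upwards [hlim.eventually (gt_mem_nhds hεδ)] with v hv θ hθ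
  exact (norm_ch_lin_sub_le (measurable_vec hX _) (measurable_vec hX _) hε.le hθ).trans_lt hv

theorem tendsto_fdch [IsProbabilityMeasure P] (hX : ∀ t, Measurable (X t))
    (hc : StochasticallyContinuous X P) {T : Type*} {l : Filter T} {σ : T → ι → ℝ≥0}
    {τ : ι → ℝ≥0} (hσ : ∀ j, Tendsto (fun v => σ v j) l (𝓝 (τ j))) (θ : ι → ℝ) :
    Tendsto (fun v => fdch P X (σ v) θ) l (𝓝 (fdch P X τ θ)) := by
  refine Metric.tendsto_nhds.2 fun δ hδ => ?_
  filter_upwards [eventually_norm_fdch_sub_lt hX hc hσ ‖θ‖ hδ] with v hv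
  rw [dist_eq_norm]
  exact hv θ le_rfl

theorem tendsto_mul_const_nhds (u t : ℝ≥0) : Tendsto (fun v => v * t) (𝓝 u) (𝓝 (u * t)) :=
  (continuous_id.mul continuous_const).tendsto u

theorem continuous_fdch_mul [IsProbabilityMeasure P] (hX : ∀ t, Measurable (X t))
    (hc : StochasticallyContinuous X P) (τ : ι → ℝ≥0) (θ : ι → ℝ) :
    Continuous fun u : ℝ≥0 => fdch P X (fun i => u * τ i) θ :=
  continuous_iff_continuousAt.2 fun u =>
    tendsto_fdch hX hc (fun j => tendsto_mul_const_nhds u (τ j)) θ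

end Continuity

/-! ### Infinite divisibility and scaling of time-stable processes -/

section TimeStableProcess

variable {Ω : Type*} [MeasurableSpace Ω] {P : Measure Ω} {X : ℝ≥0 → Ω → ℝ}
  {ι : Type*} [Fintype ι]

theorem IsTimeStable.fdch_mul (h : IsTimeStable X P) (τ : ι → ℝ≥0) (θ : ι → ℝ) (n : ℕ)
    (s : ℝ≥0) (hn : 1 ≤ n) :
    fdch P X (fun i => (n * s) * τ i) θ = fdch P X (fun i => s * τ i) θ ^ n := by
  have := h.isProbabilityMeasure
  rcases hn.eq_or_lt with rfl | hn
  · simp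
  · rw [← fdch_sumOfCopies]
    have := (h.stable n hn).ch_eq (fun i => s * τ i) θ
    rw [fdch, fdch, this]
    simp only [mul_assoc]

/-- At time 0 stability forces φ = φ², so φ takes only the values 0 and 1. It is continuous in θ on
a connected space and equals 1 at θ = 0. -/
theorem IsTimeStable.fdch_zero_mul (h : IsTimeStable X P) (τ : ι → ℝ≥0) (θ : ι → ℝ) :
    fdch P X (fun i => 0 * τ i) θ = 1 := by
  have := h.isProbabilityMeasure
  have hidem (θ : ι → ℝ) : fdch P X (fun i => 0 * τ i) θ = 0 ∨
      fdch P X (fun i => 0 * τ i) θ = 1 := by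
    have h2 := h.fdch_mul τ θ 2 0 (by norm_num)
    rw [mul_zero] at h2
    have : fdch P X (fun i => 0 * τ i) θ * (fdch P X (fun i => 0 * τ i) θ - 1) = 0 := by
      rw [mul_sub, mul_one, ← sq, ← h2, sub_self]
    rcases mul_eq_zero.1 this with h | h
    · exact Or.inl h
    · exact Or.inr (sub_eq_zero.1 h)
  have hcont : Continuous fun θ => fdch P X (fun i => 0 * τ i) θ := continuous_fdch h.measurable _
  have hclopen : IsClopen {θ : ι → ℝ | fdch P X (fun i => 0 * τ i) θ = 1} := by
    refine ⟨isClosed_eq hcont continuous_const, ?_⟩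
    have : {θ : ι → ℝ | fdch P X (fun i => 0 * τ i) θ = 1}
        = {θ | fdch P X (fun i => 0 * τ i) θ ≠ 0} := by
      ext θ
      simp only [Set.mem_ofPred_eq, ne_eq]
      rcases hidem θ with h | h <;> rw [h] <;> simp
    rw [this]
    exact isOpen_ne_fun hcont continuous_const
  have := hclopen.eq_univ ⟨0, fdch_zero _⟩
  exact this.ge (Set.mem_univ θ)

/-- The finite-dimensional distributions of a time-stable process have a characteristic exponent
which is continuous at the origin. -/
theorem IsTimeStable.exists_exponent (h : IsTimeStable X P) (τ : ι → ℝ≥0) :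
    ∃ ψ : (ι → ℝ) → ℂ, ContinuousAt ψ 0 ∧ ψ 0 = 0 ∧ ∀ (n : ℕ) (θ : ι → ℝ), 1 ≤ n →
      fdch P X (fun i => 1 / n * τ i) θ = Complex.exp (ψ θ / n) := by
  have := h.isProbabilityMeasure
  have hN (K : ℝ) : ∃ N : ℕ, 1 ≤ N ∧ ∀ θ : ι → ℝ, ‖θ‖ ≤ K → ∀ s : ℝ≥0, s ≤ 1 / N →
      ‖fdch P X (fun i => s * τ i) θ - 1‖ < 1 := by
    have hev := eventually_norm_fdch_sub_lt h.measurable h.stochasticallyContinuous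
      (fun j => tendsto_mul_const_nhds 0 (τ j)) K one_pos
    obtain ⟨ε, hε, hball⟩ := Metric.eventually_nhds_iff.1 hev
    obtain ⟨N, hNε⟩ := exists_nat_one_div_lt hε
    refine ⟨N + 1, by lia, fun θ hθ s hs => ?_⟩
    have := hball (y := s) (by
      rw [NNReal.dist_eq, NNReal.coe_zero, sub_zero, abs_of_nonneg (NNReal.coe_nonneg s)]
      refine lt_of_le_of_lt ?_ hNε
      exact_mod_cast hs) θ hθ
    rwa [h.fdch_zero_mul] at this
  choose N hN1 hN using hN
  -- The scale depends on θ only through max 1 ‖θ‖, so it is constant on the unit ball; this yields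
  -- continuity of the exponent at 0, the only place where it is required.
  refine ⟨fun θ => N (max 1 ‖θ‖) *
    Complex.log (fdch P X (fun i => 1 / (N (max 1 ‖θ‖) : ℝ≥0) * τ i) θ), ?_, ?_, ?_⟩
  · have hcont : ContinuousAt (fun θ : ι → ℝ => N 1 *
        Complex.log (fdch P X (fun i => 1 / (N 1 : ℝ≥0) * τ i) θ)) 0 := by
      refine continuousAt_const.mul (ContinuousAt.clog
        (continuous_fdch h.measurable _).continuousAt ?_)
      rw [fdch_zero]
      exact Complex.one_mem_slitPlane
    refine hcont.congr ?_
    filter_upwards [Metric.closedBall_mem_nhds (0 : ι → ℝ) one_pos] with θ hθ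
    rw [mem_closedBall_zero_iff] at hθ
    rw [max_eq_left hθ]
  · simp [fdch_zero]
  · intro n θ hn
    exact exists_eq_exp_div (f := fun s => fdch P X (fun i => s * τ i) θ)
      (fun n s hn => h.fdch_mul τ θ n s hn) (hN1 _) (hN _ θ (le_max_right _ _)) n hn

/-- The **Lévy–Khintchine representation** of the finite-dimensional distributions of a time-stable
process. -/
theorem IsTimeStable.exists_fdch_eq (h : IsTimeStable X P) (τ : ι → ℝ≥0) :
    ∃ (b : ι → ℝ) (A : Matrix ι ι ℝ) (ν : Measure (ι → ℝ)), A.PosSemidef ∧ ν {0} = 0 ∧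
      ∫⁻ x, ENNReal.ofReal (min 1 (‖x‖ ^ 2)) ∂ν < ∞ ∧
      ∀ θ, fdch P X τ θ = Complex.exp (levyExponent b A ν θ) := by
  have := h.isProbabilityMeasure
  obtain ⟨ψ, hψ, hψ0, hψn⟩ := h.exists_exponent τ
  have hm (n : ℕ) := measurable_vec h.measurable fun i => 1 / ((n + 1 : ℕ) : ℝ≥0) * τ i
  have (n : ℕ) := Measure.isProbabilityMeasure_map (μ := P) (hm n).aemeasurable
  obtain ⟨b, A, ν, hA, hν0, hν, hb⟩ := exists_levyExponent
    (μ := fun n : ℕ => P.map fun ω i => X (1 / ((n + 1 : ℕ) : ℝ≥0) * τ i) ω) hψ hψ0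
    fun n θ => by
      rw [ch_map (hm n).aemeasurable (measurable_lin θ)]
      have := hψn (n + 1) θ (by lia)
      rw [fdch] at this
      rw [this]
      push_cast
      rfl
  refine ⟨b, A, ν, hA, hν0, hν, fun θ => ?_⟩
  have := hψn 1 θ le_rfl
  simp only [Nat.cast_one, div_one, one_mul] at this
  rw [this, hb]

/-- The modulus of the characteristic function scales with time. -/
theorem IsTimeStable.log_norm_fdch_mul (h : IsTimeStable X P) (τ : ι → ℝ≥0) (θ : ι → ℝ)
    (u : ℝ≥0) :
    Real.log ‖fdch P X (fun i => u * τ i) θ‖ = u * Real.log ‖fdch P X τ θ‖ := by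
  have := h.isProbabilityMeasure
  have hne (σ : ι → ℝ≥0) : fdch P X σ θ ≠ 0 := by
    obtain ⟨b, A, ν, -, -, -, hb⟩ := h.exists_fdch_eq σ
    rw [hb]
    exact Complex.exp_ne_zero _
  -- Passing to the modulus makes the logarithm real and continuous in u, so integer scaling extends
  -- to rational and then to real factors.
  set g : ℝ≥0 → ℝ := fun u => Real.log ‖fdch P X (fun i => u * τ i) θ‖
  have hg : Continuous g :=
    (continuous_fdch_mul h.measurable h.stochasticallyContinuous τ θ).norm.log
      fun u => norm_ne_zero_iff.2 (hne _)
  have hgn (n : ℕ) (s : ℝ≥0) (hn : 1 ≤ n) : g (n * s) = n * g s := by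
    simp only [g]
    rw [h.fdch_mul τ θ n s hn, norm_pow, Real.log_pow]
  have hg0 : g 0 = 0 := by simp only [g]; rw [h.fdch_zero_mul, norm_one, Real.log_one]
  have hgn' (n : ℕ) (s : ℝ≥0) : g (n * s) = n * g s := by
    rcases Nat.eq_zero_or_pos n with rfl | hn
    · simp [hg0]
    · exact hgn n s hn
  have hrat (m k : ℕ) (hm : 1 ≤ m) : g (k / m) = k / m * g 1 := by
    have hm0 : (m : ℝ≥0) ≠ 0 := by exact_mod_cast (by lia : m ≠ 0)
    have hm0' : (m : ℝ) ≠ 0 := by exact_mod_cast (by lia : m ≠ 0)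
    have h1 := hgn' k (1 / m)
    have h2 := hgn' m (1 / m)
    rw [mul_one_div_cancel hm0] at h2
    rw [mul_one_div] at h1
    rw [h1, h2]
    field_simp
  -- The rationals ⌊u m⌋ / m approximate u.
  have hlim : Tendsto (fun m : ℕ => (⌊(u : ℝ) * m⌋₊ : ℝ≥0) / m) atTop (𝓝 u) := by
    refine NNReal.tendsto_coe.1 ?_
    push_cast
    exact (tendsto_nat_floor_mul_div_atTop (R := ℝ) (NNReal.coe_nonneg u)).comp
      tendsto_natCast_atTop_atTop
  have h1 := (hg.tendsto u).comp hlim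
  have h2 : Tendsto (fun m : ℕ => (((⌊(u : ℝ) * m⌋₊ : ℝ≥0) / m : ℝ≥0) : ℝ) * g 1) atTop
      (𝓝 (u * g 1)) := ((NNReal.continuous_coe.tendsto u).comp hlim).mul_const _
  have h3 := tendsto_nhds_unique (h1.congr' (by
    filter_upwards [eventually_ge_atTop 1] with m hm
    simp only [Function.comp_apply]
    rw [hrat m _ hm]
    push_cast
    rfl)) h2
  simpa [g] using h3

end TimeStableProcess

end

end TimeStable

/-! ### Kolmogorov extension -/

namespace TimeStable

/-- A family of compact constraints on finitely many coordinates each, every finite subfamily of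
which can be satisfied, can be satisfied simultaneously. -/
theorem exists_forall_restrict_mem_of_isCompact {ι : Type*} (s : ℕ → Finset ι)
    (K : ∀ n, Set (s n → ℝ)) (hK : ∀ n, IsCompact (K n))
    (h : ∀ N, ∃ x : ι → ℝ, ∀ k ≤ N, (s k).restrict x ∈ K k) :
    ∃ x : ι → ℝ, ∀ k, (s k).restrict x ∈ K k := by
  choose x hx using h
  have hev (k : ℕ) : ∀ᶠ N in (hyperfilter ℕ : Filter ℕ), (s k).restrict (x N) ∈ K k :=
    (eventually_ge_atTop k).filter_mono Nat.hyperfilter_le_atTop |>.mono fun N hN => hx N k hN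
  have hlim (i : ι) : ∃ y : ℝ, (∃ k, i ∈ s k) →
      Tendsto (fun N => x N i) (hyperfilter ℕ : Filter ℕ) (𝓝 y) := by
    by_cases hi : ∃ k, i ∈ s k
    · obtain ⟨k, hk⟩ := hi
      have hc : IsCompact ((fun z : s k → ℝ => z ⟨i, hk⟩) '' K k) :=
        (hK k).image (continuous_apply _)
      obtain ⟨y, -, hy⟩ := hc.ultrafilter_le_nhds ((hyperfilter ℕ).map fun N => x N i) (by
        rw [Ultrafilter.coe_map, le_principal_iff, mem_map]
        filter_upwards [hev k] with N hN using ⟨_, hN, rfl⟩)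
      exact ⟨y, fun _ => hy⟩
    · exact ⟨0, fun h => (hi h).elim⟩
  choose y hy using hlim
  refine ⟨y, fun k => (hK k).isClosed.mem_of_tendsto ?_ (hev k)⟩
  exact tendsto_pi_nhds.2 fun i => hy i ⟨k, i.2⟩

/-- The content of a projective family of probability laws on `ℝ^I` is continuous at `∅`. -/
theorem projectiveFamilyContent_tendsto_zero {ι : Type*}
    {P : ∀ J : Finset ι, Measure (J → ℝ)} [∀ J, IsProbabilityMeasure (P J)]
    (hP : IsProjectiveMeasureFamily (α := fun _ => ℝ) P) {A : ℕ → Set (ι → ℝ)}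
    (A_mem : ∀ n, A n ∈ measurableCylinders (fun _ : ι => ℝ)) (A_anti : Antitone A)
    (A_inter : ⋂ n, A n = ∅) :
    Tendsto (fun n => projectiveFamilyContent hP (A n)) atTop (𝓝 0) := by
  set m := projectiveFamilyContent hP
  have m_anti : Antitone fun n => m (A n) := fun a b hab =>
    projectiveFamilyContent_mono hP (A_mem b) (A_mem a) (A_anti hab)
  have hlim := tendsto_atTop_iInf m_anti
  suffices h0 : ⨅ n, m (A n) = 0 by rwa [h0] at hlim
  by_contra hne
  set ε := ⨅ n, m (A n)
  -- Tolerances with total below the supposed positive limit ε, to be spent on inner approximation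
  -- by compact sets.
  obtain ⟨δ, δ_pos, hδ⟩ := ENNReal.exists_pos_sum_of_countable' hne ℕ
  have A_cyl n : ∃ s S, MeasurableSet S ∧ A n = cylinder s S :=
    (mem_measurableCylinders _).1 (A_mem n)
  choose s S mS A_eq using A_cyl
  have hKex n : ∃ K ⊆ S n, IsCompact K ∧ P (s n) (S n \ K) < δ n :=
    (mS n).exists_isCompact_sdiff_lt (measure_ne_top _ _) (δ_pos n).ne'
  choose K hKS hKc hKδ using hKex
  -- If no point met the first N + 1 compact constraints, `A N` would be covered by the discarded
  -- pieces, whose total content is below ε. A point meeting all of them lies in every `A n`.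
  obtain ⟨x, hx⟩ := exists_forall_restrict_mem_of_isCompact s K hKc fun N => by
    by_contra! hcon
    have hsub : A N ⊆ ⋃ k ≤ N, cylinder (s k) (S k \ K k) := by
      intro x hxN
      obtain ⟨k, hk, hxk⟩ := hcon x
      simp only [Set.mem_iUnion]
      refine ⟨k, hk, ?_⟩
      have : x ∈ A k := A_anti hk hxN
      rw [A_eq, mem_cylinder] at this
      exact (mem_cylinder _ _ _).2 ⟨this, hxk⟩
    have mD k : MeasurableSet (S k \ K k) := (mS k).diff (hKc k).measurableSet
    have hcyl k : cylinder (s k) (S k \ K k) ∈ measurableCylinders (fun _ : ι => ℝ) :=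
      cylinder_mem_measurableCylinders _ _ (mD k)
    have hU : (⋃ k ≤ N, cylinder (s k) (S k \ K k)) ∈ measurableCylinders (fun _ : ι => ℝ) := by
      have := isSetRing_measurableCylinders (α := fun _ : ι => ℝ) |>.biUnion_mem
        (Finset.range (N + 1)) (fun k _ => hcyl k)
      simpa [Nat.lt_succ_iff] using this
    have h1 : m (A N) ≤ ∑ k ∈ Finset.range (N + 1), δ k :=
      calc m (A N) ≤ m (⋃ k ≤ N, cylinder (s k) (S k \ K k)) :=
            projectiveFamilyContent_mono hP (A_mem N) hU hsub
        _ ≤ ∑ k ∈ Finset.range (N + 1), m (cylinder (s k) (S k \ K k)) :=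
            projectiveFamilyContent_iUnion_le hP hcyl N
        _ ≤ ∑ k ∈ Finset.range (N + 1), δ k := by
            refine Finset.sum_le_sum fun k _ => ?_
            rw [projectiveFamilyContent_cylinder hP (mD k)]
            exact (hKδ k).le
    exact absurd ((iInf_le _ N).trans (h1.trans (ENNReal.sum_le_tsum _))) (not_le.2 hδ)
  have : x ∈ ⋂ n, A n := Set.mem_iInter.2 fun n => by
    rw [A_eq, mem_cylinder]
    exact hKS n (hx n)
  rw [A_inter] at this
  exact this

/-- The **Kolmogorov extension theorem** for real-valued processes. -/
theorem exists_isProjectiveLimit {ι : Type*}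
    {P : ∀ J : Finset ι, Measure (J → ℝ)} [∀ J, IsProbabilityMeasure (P J)]
    (hP : IsProjectiveMeasureFamily (α := fun _ => ℝ) P) :
    ∃ μ : Measure (ι → ℝ), IsProbabilityMeasure μ ∧
      ∀ I : Finset ι, μ.map I.restrict = P I := by
  have hσ : (projectiveFamilyContent hP).IsSigmaSubadditive := by
    refine isSigmaSubadditive_of_addContent_iUnion_eq_tsum
      isSetRing_measurableCylinders (fun f hf hf_Union hf' => ?_)
    exact addContent_iUnion_eq_sum_of_tendsto_zero isSetRing_measurableCylinders
      (projectiveFamilyContent hP) (fun s hs => projectiveFamilyContent_ne_top _)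
      (fun _ => projectiveFamilyContent_tendsto_zero hP) hf hf_Union hf'
  set μ := (projectiveFamilyContent hP).measure isSetSemiring_measurableCylinders
      generateFrom_measurableCylinders.ge hσ
  have hμ (I : Finset ι) : μ.map I.restrict = P I := by
    ext s hs
    rw [Measure.map_apply (Finset.measurable_restrict I) hs, AddContent.measure_eq,
      ← cylinder, projectiveFamilyContent_cylinder hP hs]
    · exact generateFrom_measurableCylinders.symm
    · exact cylinder_mem_measurableCylinders _ _ hs
  refine ⟨μ, ⟨?_⟩, hμ⟩
  have := congrArg (fun ν => ν Set.univ) (hμ ∅)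
  simpa [Measure.map_apply (Finset.measurable_restrict (∅ : Finset ι)) MeasurableSet.univ]
    using this

end TimeStable

namespace TimeStable

noncomputable section

/-! ### The intrinsic Gaussian covariance and its removal -/

section GaussianVariance

variable {Ω : Type*} [MeasurableSpace Ω] {P : Measure Ω} {X : ℝ≥0 → Ω → ℝ}
  {ι : Type*} [Fintype ι]

/-- The variance of the Gaussian component of an infinitely divisible random variable, read off
the decay of its characteristic function. -/
def gaussVar (P : Measure Ω) (Y : Ω → ℝ) : ℝ :=
  limUnder atTop fun r : ℝ => -2 * Real.log ‖ch P fun ω => r * Y ω‖ / r ^ 2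

/-- The covariance of the Gaussian components of a process, by polarization. -/
def gaussCov (P : Measure Ω) (X : ℝ≥0 → Ω → ℝ) (t s : ℝ≥0) : ℝ :=
  (gaussVar P (fun ω => X t ω + X s ω) - gaussVar P (X t) - gaussVar P (X s)) / 2

/-- Since the limit defining `gaussVar` does not mention a triplet, any representation of any family
containing the same linear combination yields the same value. -/
theorem gaussVar_eq {b : ι → ℝ} {A : Matrix ι ι ℝ} {ν : Measure (ι → ℝ)}
    (hν : Integrable levyWeight ν) {τ : ι → ℝ≥0}
    (h : ∀ θ, fdch P X τ θ = Complex.exp (levyExponent b A ν θ)) (θ : ι → ℝ) :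
    gaussVar P (fun ω => lin θ fun i => X (τ i) ω) = ∑ j, ∑ k, θ j * A j k * θ k := by
  refine Tendsto.limUnder_eq ((tendsto_re_levyExponent_div_sq hν b A θ).congr fun r => ?_)
  simp_rw [← lin_smul]
  have := h (r • θ)
  rw [fdch] at this
  rw [this, Complex.norm_exp, Real.log_exp]

/-- The log-modulus scales exactly with time at every frequency r, and the limit in r inherits the
factor. -/
theorem IsTimeStable.gaussVar_mul (h : IsTimeStable X P) (τ : ι → ℝ≥0) (θ : ι → ℝ) (u : ℝ≥0) :
    gaussVar P (fun ω => lin θ fun i => X (u * τ i) ω) =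
      u * gaussVar P (fun ω => lin θ fun i => X (τ i) ω) := by
  obtain ⟨b, A, ν, -, -, hν, hb⟩ := h.exists_fdch_eq τ
  have hlim := tendsto_re_levyExponent_div_sq (integrable_levyWeight hν) b A θ
  rw [gaussVar_eq (integrable_levyWeight hν) hb]
  refine Tendsto.limUnder_eq ((hlim.const_mul (u : ℝ)).congr fun r => ?_)
  have h1 := h.log_norm_fdch_mul τ (r • θ) u
  rw [hb, Complex.norm_exp, Real.log_exp, fdch] at h1
  simp_rw [← lin_smul]
  rw [h1]
  ring

theorem lin_comp_pair {Ω : Type*} (X : ℝ≥0 → Ω → ℝ) (a b : ℝ) (t s : ℝ≥0) (ω : Ω) :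
    lin ![a, b] (fun i => X (![t, s] i) ω) = a * X t ω + b * X s ω := by
  simp [lin]

theorem IsTimeStable.gaussCov_mul (h : IsTimeStable X P) (u t s : ℝ≥0) :
    gaussCov P X (u * t) (u * s) = u * gaussCov P X t s := by
  have h1 (a b : ℝ) : gaussVar P (fun ω => a * X (u * t) ω + b * X (u * s) ω) =
      u * gaussVar P (fun ω => a * X t ω + b * X s ω) := by
    have := h.gaussVar_mul ![t, s] ![a, b] u
    simp_rw [lin_comp_pair] at this
    rw [← this]
    congr 1 with ω
    simp [lin]
  have h2 := h1 1 1
  have h3 := h1 1 0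
  have h4 := h1 0 1
  simp only [one_mul, zero_mul, add_zero, zero_add] at h2 h3 h4
  simp only [gaussCov, h2]
  rw [show gaussVar P (X (u * t)) = u * gaussVar P (X t) from h3,
    show gaussVar P (X (u * s)) = u * gaussVar P (X s) from h4]
  ring

/-- Polarization at the basis vectors recovers the symmetric matrix A. The Gaussian matrices of all
finite families are thus restrictions of one function of two times, which makes them consistent. -/
theorem gaussCov_eq {b : ι → ℝ} {A : Matrix ι ι ℝ} {ν : Measure (ι → ℝ)} (hA : A.PosSemidef)
    (hν : Integrable levyWeight ν) {τ : ι → ℝ≥0}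
    (h : ∀ θ, fdch P X τ θ = Complex.exp (levyExponent b A ν θ)) (j k : ι) :
    gaussCov P X (τ j) (τ k) = A j k := by
  classical
  have hquad (θ : ι → ℝ) : ∑ j, ∑ k, θ j * A j k * θ k = lin θ (fun j => lin θ (A j)) := by
    simp only [lin, Finset.mul_sum]
    refine Finset.sum_congr rfl fun j _ => Finset.sum_congr rfl fun k _ => by ring
  have hsymm : A k j = A j k := by simpa using hA.1.apply j k
  have hlin (θ η x : ι → ℝ) : lin (θ + η) x = lin θ x + lin η x := by
    simp [lin, add_mul, Finset.sum_add_distrib]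
  have h1 := gaussVar_eq hν h (Pi.single j 1 + Pi.single k 1)
  have h2 := gaussVar_eq hν h (Pi.single j 1)
  have h3 := gaussVar_eq hν h (Pi.single k 1)
  simp only [hquad, hlin, lin_single, one_mul] at h1 h2 h3
  rw [gaussCov, h1, show gaussVar P (X (τ j)) = _ from h2, show gaussVar P (X (τ k)) = _ from h3,
    hsymm]
  ring

/-- The matrix of Gaussian covariances along a family of times. -/
def gaussMatrix (P : Measure Ω) (X : ℝ≥0 → Ω → ℝ) (τ : ι → ℝ≥0) : Matrix ι ι ℝ :=
  Matrix.of fun j k => gaussCov P X (τ j) (τ k)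

theorem IsTimeStable.posSemidef_gaussMatrix (h : IsTimeStable X P) (τ : ι → ℝ≥0) :
    (gaussMatrix P X τ).PosSemidef := by
  obtain ⟨b, A, ν, hA, -, hν, hb⟩ := h.exists_fdch_eq τ
  convert hA
  ext j k
  exact gaussCov_eq hA (integrable_levyWeight hν) hb j k

theorem IsTimeStable.gaussVar_eq (h : IsTimeStable X P) (τ : ι → ℝ≥0) (θ : ι → ℝ) :
    gaussVar P (fun ω => lin θ fun i => X (τ i) ω) =
      ∑ j, ∑ k, θ j * gaussMatrix P X τ j k * θ k := by
  obtain ⟨b, A, ν, hA, -, hν, hb⟩ := h.exists_fdch_eq τ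
  rw [TimeStable.gaussVar_eq (integrable_levyWeight hν) hb]
  refine Finset.sum_congr rfl fun j _ => Finset.sum_congr rfl fun k _ => ?_
  rw [← gaussCov_eq hA (integrable_levyWeight hν) hb j k]
  rfl

/-- Removing the Gaussian component from the finite-dimensional characteristic functions. -/
theorem IsTimeStable.exists_fdch_mul_exp_eq (h : IsTimeStable X P) (τ : ι → ℝ≥0) :
    ∃ (b : ι → ℝ) (ν : Measure (ι → ℝ)), ν {0} = 0 ∧
      ∫⁻ x, ENNReal.ofReal (min 1 (‖x‖ ^ 2)) ∂ν < ∞ ∧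
      ∀ θ, fdch P X τ θ * Complex.exp
        ((gaussVar P (fun ω => lin θ fun i => X (τ i) ω) / 2 : ℝ) : ℂ) =
          Complex.exp (levyExponent b 0 ν θ) := by
  obtain ⟨b, A, ν, hA, hν0, hν, hb⟩ := h.exists_fdch_eq τ
  refine ⟨b, ν, hν0, hν, fun θ => ?_⟩
  rw [TimeStable.gaussVar_eq (integrable_levyWeight hν) hb, hb, ← Complex.exp_add]
  simp only [levyExponent, Matrix.zero_apply, mul_zero, zero_mul, Finset.sum_const_zero, zero_div,
    Complex.ofReal_zero]
  ring_nf

theorem IsCharFun.norm_le_one {f : (ι → ℝ) → ℂ} (hf : IsCharFun f) (θ : ι → ℝ) : ‖f θ‖ ≤ 1 := by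
  obtain ⟨μ, hμ, h⟩ := hf
  rw [← h]
  exact norm_ch_le_one _ _

/-- A characteristic function divided by a Gaussian one need not be a characteristic function; here
the remaining triplet (b, 0, ν) ensures it. -/
theorem IsTimeStable.isCharFun_fdch_mul_exp (h : IsTimeStable X P) (τ : ι → ℝ≥0) :
    IsCharFun fun θ => fdch P X τ θ * Complex.exp
        ((gaussVar P (fun ω => lin θ fun i => X (τ i) ω) / 2 : ℝ) : ℂ) := by
  obtain ⟨b, ν, -, hν, hb⟩ := h.exists_fdch_mul_exp_eq τ
  simp_rw [hb]
  exact isCharFun_exp_levyExponent (integrable_levyWeight hν) b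

theorem IsTimeStable.gaussVar_nonneg (h : IsTimeStable X P) (τ : ι → ℝ≥0) (θ : ι → ℝ) :
    0 ≤ gaussVar P (fun ω => lin θ fun i => X (τ i) ω) := by
  rw [h.gaussVar_eq]
  have := (h.posSemidef_gaussMatrix τ).dotProduct_mulVec_nonneg θ
  rwa [star_trivial, dotProduct_mulVec_eq_sum] at this

/-- The non-Gaussian factor has modulus at most 1, so the Gaussian factor alone cannot decay faster
than φ. This later forces the Gaussian variance of small increments to vanish. -/
theorem IsTimeStable.gaussVar_le (h : IsTimeStable X P) (τ : ι → ℝ≥0) (θ : ι → ℝ) :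
    gaussVar P (fun ω => lin θ fun i => X (τ i) ω) ≤ -2 * Real.log ‖fdch P X τ θ‖ := by
  have h1 := (h.isCharFun_fdch_mul_exp τ).norm_le_one θ
  obtain ⟨b, A, ν, -, -, hν, hb⟩ := h.exists_fdch_eq τ
  rw [hb, norm_mul, Complex.norm_exp, Complex.norm_exp, ← Real.exp_add, Real.exp_le_one_iff,
    Complex.ofReal_re] at h1
  rw [hb, Complex.norm_exp, Real.log_exp]
  linarith

end GaussianVariance

/-! ### Recognizing Gaussian vectors and processes -/

section Gaussian

variable {ι : Type*} [Fintype ι] [DecidableEq ι]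

theorem ch_multivariateGaussian {S : Matrix ι ι ℝ} (hS : S.PosSemidef) (θ : ι → ℝ) :
    ch ((multivariateGaussian 0 S).map (EuclideanSpace.equiv ι ℝ)) (lin θ) =
      Complex.exp ((-(∑ j, ∑ k, θ j * S j k * θ k) / 2 : ℝ) : ℂ) := by
  have h := charFun_map_toLp ((multivariateGaussian 0 S).map (EuclideanSpace.equiv ι ℝ))
    (WithLp.toLp 2 θ)
  rw [Measure.map_map (by fun_prop) (by fun_prop)] at h
  rw [← h]
  have : (WithLp.toLp 2 : (ι → ℝ) → _) ∘ (EuclideanSpace.equiv ι ℝ) = id := by ext; rfl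
  rw [this, Measure.map_id, charFun_multivariateGaussian hS]
  rw [dotProduct_mulVec_eq_sum]
  simp [neg_div]

theorem map_eq_multivariateGaussian {Ω : Type*} [MeasurableSpace Ω] {P : Measure Ω}
    [IsProbabilityMeasure P] {X : Ω → ι → ℝ} (hX : Measurable X) {S : Matrix ι ι ℝ}
    (hS : S.PosSemidef) (h : ∀ θ, ch P (fun ω => lin θ (X ω)) =
      Complex.exp ((-(∑ j, ∑ k, θ j * S j k * θ k) / 2 : ℝ) : ℂ)) :
    P.map X = (multivariateGaussian 0 S).map (EuclideanSpace.equiv ι ℝ) := by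
  have := Measure.isProbabilityMeasure_map (μ := P) hX.aemeasurable
  refine measure_ext_of_ch fun θ => ?_
  rw [ch_map hX.aemeasurable (measurable_lin θ), h, ch_multivariateGaussian hS]

theorem hasGaussianLaw_of_ch {Ω : Type*} [MeasurableSpace Ω] {P : Measure Ω}
    [IsProbabilityMeasure P] {X : Ω → ι → ℝ} (hX : Measurable X) {S : Matrix ι ι ℝ}
    (hS : S.PosSemidef) (h : ∀ θ, ch P (fun ω => lin θ (X ω)) =
      Complex.exp ((-(∑ j, ∑ k, θ j * S j k * θ k) / 2 : ℝ) : ℂ)) :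
    HasGaussianLaw X P := by
  refine ⟨?_⟩
  rw [map_eq_multivariateGaussian hX hS h]
  infer_instance

theorem covariance_of_ch {Ω : Type*} [MeasurableSpace Ω] {P : Measure Ω}
    [IsProbabilityMeasure P] {X : Ω → ι → ℝ} (hX : Measurable X) {S : Matrix ι ι ℝ}
    (hS : S.PosSemidef) (h : ∀ θ, ch P (fun ω => lin θ (X ω)) =
      Complex.exp ((-(∑ j, ∑ k, θ j * S j k * θ k) / 2 : ℝ) : ℂ)) (i j : ι) :
    cov[fun ω => X ω i, fun ω => X ω j; P] = S i j := by
  have h1 := covariance_map (μ := P) (X := fun x : ι → ℝ => x i) (Y := fun x : ι → ℝ => x j)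
    (Z := X) (measurable_pi_apply i).aestronglyMeasurable
    (measurable_pi_apply j).aestronglyMeasurable hX.aemeasurable
  have h2 := covariance_map (μ := multivariateGaussian 0 S) (X := fun x : ι → ℝ => x i)
    (Y := fun x : ι → ℝ => x j)
    (Z := EuclideanSpace.equiv ι ℝ) (measurable_pi_apply i).aestronglyMeasurable
    (measurable_pi_apply j).aestronglyMeasurable (by fun_prop)
  rw [← map_eq_multivariateGaussian hX hS h, h1] at h2
  exact h2.trans (covariance_eval_multivariateGaussian hS i j)

theorem integral_of_ch {Ω : Type*} [MeasurableSpace Ω] {P : Measure Ω}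
    [IsProbabilityMeasure P] {X : Ω → ι → ℝ} (hX : Measurable X) {S : Matrix ι ι ℝ}
    (hS : S.PosSemidef) (h : ∀ θ, ch P (fun ω => lin θ (X ω)) =
      Complex.exp ((-(∑ j, ∑ k, θ j * S j k * θ k) / 2 : ℝ) : ℂ)) (i : ι) :
    ∫ ω, X ω i ∂P = 0 := by
  rw [← integral_map (φ := X) (f := fun x => x i) hX.aemeasurable
    (measurable_pi_apply i).aestronglyMeasurable, map_eq_multivariateGaussian hX hS h,
    integral_map (f := fun x : ι → ℝ => x i) (by fun_prop)
      (measurable_pi_apply i).aestronglyMeasurable]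
  have h2 := (EuclideanSpace.proj (𝕜 := ℝ) i : EuclideanSpace ℝ ι →L[ℝ] ℝ).integral_comp_id_comm
    (μ := multivariateGaussian 0 S) IsGaussian.integrable_id
  rw [integral_id_multivariateGaussian, map_zero] at h2
  exact h2

theorem isCentredGaussian_of_fdch {Ω : Type*} [MeasurableSpace Ω] {P : Measure Ω}
    [IsProbabilityMeasure P] {G : ℝ≥0 → Ω → ℝ} {C : ℝ≥0 → ℝ≥0 → ℝ}
    (hG : ∀ t, Measurable (G t))
    (hC : ∀ {n : Type} [Fintype n] (τ : n → ℝ≥0),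
      (Matrix.of fun j k => C (τ j) (τ k)).PosSemidef)
    (h : ∀ {n : Type} [Fintype n] (τ : n → ℝ≥0) (θ : n → ℝ), fdch P G τ θ =
      Complex.exp ((-(∑ j, ∑ k, θ j * C (τ j) (τ k) * θ k) / 2 : ℝ) : ℂ)) :
    IsCentredGaussian G C P where
  measurable := hG
  isGaussianProcess := ⟨fun I => hasGaussianLaw_of_ch (X := fun ω => I.restrict (G · ω))
    (measurable_vec hG fun i : I => i) (hC fun i : I => i) (h fun i : I => i)⟩
  centred t := integral_of_ch (measurable_vec hG ![t]) (hC ![t]) (h ![t]) 0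
  covariance_eq t s := covariance_of_ch (measurable_vec hG ![t, s]) (hC ![t, s]) (h ![t, s]) 0 1

end Gaussian

/-! ### Processes from consistent characteristic functions -/

section Construction

/-- A family τ may repeat times; the finitely supported sum merges the coefficients, reducing
families to finite sets of times. -/
theorem lin_comp_eq {T n : Type*} [Fintype n] {I : Finset T} {τ : n → T} (hτ : ∀ j, τ j ∈ I)
    (θ : n → ℝ) (x : T → ℝ) :
    lin (fun i : I => (∑ j, Finsupp.single (τ j) (θ j)) (i : T)) (fun i : I => x i) =
      lin θ fun j => x (τ j) := by
  classical
  simp only [lin, Finsupp.finsetSum_apply, Finset.sum_mul]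
  rw [Finset.sum_comm]
  refine Finset.sum_congr rfl fun j _ => ?_
  rw [Finset.sum_eq_single (⟨τ j, hτ j⟩ : I)]
  · simp
  · intro i _ hi
    rw [Finsupp.single_apply, if_neg, zero_mul]
    exact fun h => hi (Subtype.ext h.symm)
  · simp

theorem sum_single_eq {T : Type*} {I : Finset T} (f : T →₀ ℝ) (hf : f.support ⊆ I) :
    ∑ i : I, Finsupp.single (i : T) (f i) = f := by
  conv_rhs => rw [← Finsupp.sum_single f, Finsupp.sum_of_support_subset f hf _ (by simp)]
  exact Finset.sum_coe_sort I fun i => Finsupp.single i (f i)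

theorem support_sum_single_subset {T n : Type*} [Fintype n] {I : Finset T} {τ : n → T}
    (hτ : ∀ j, τ j ∈ I) (θ : n → ℝ) : (∑ j, Finsupp.single (τ j) (θ j)).support ⊆ I := by
  classical
  refine Finsupp.support_finsetSum.trans fun i hi => ?_
  obtain ⟨j, -, hj⟩ := Finset.mem_biUnion.1 hi
  rw [Finset.mem_singleton.1 (Finsupp.support_single_subset hj)]
  exact hτ j

/-- A real process is determined by a consistent family of characteristic functions, here given
by a function on the finitely supported coefficient vectors. -/
theorem exists_measure_of_isCharFun {T : Type*} (Φ : (T →₀ ℝ) → ℂ)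
    (h : ∀ I : Finset T, IsCharFun fun θ : I → ℝ => Φ (∑ i : I, Finsupp.single (i : T) (θ i))) :
    ∃ μ : Measure (T → ℝ), IsProbabilityMeasure μ ∧
      ∀ {n : Type} [Fintype n] (τ : n → T) (θ : n → ℝ),
        ch μ (fun x => lin θ fun j => x (τ j)) = Φ (∑ j, Finsupp.single (τ j) (θ j)) := by
  classical
  choose Q hQ hch using h
  beta_reduce at hch
  -- Consistency is automatic: Φ sees only the coefficient vector on T, which does not change when
  -- the index set is enlarged by zero coefficients.
  have key {n : Type _} [Fintype n] {I : Finset T} {τ : n → T} (hτ : ∀ j, τ j ∈ I) (θ : n → ℝ) :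
      ch (Q I) (fun x => lin θ fun j => x ⟨τ j, hτ j⟩) = Φ (∑ j, Finsupp.single (τ j) (θ j)) := by
    rw [← sum_single_eq _ (support_sum_single_subset hτ θ), ← hch]
    congr 1 with x
    have := lin_comp_eq hτ θ fun t => if ht : t ∈ I then x ⟨t, ht⟩ else 0
    simpa [hτ] using this.symm
  have hproj : IsProjectiveMeasureFamily (α := fun _ => ℝ) Q := by
    intro I J hJI
    refine measure_ext_of_ch fun θ => ?_
    have hm : Measurable fun (x : I → ℝ) (j : J) => x ⟨j, hJI j.2⟩ := by fun_prop
    exact (hch J θ).trans ((key (fun j : J => hJI j.2) θ).symm.trans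
      (ch_map (P := Q I) hm.aemeasurable (measurable_lin θ)).symm)
  obtain ⟨μ, hμ, hmap⟩ := exists_isProjectiveLimit hproj
  refine ⟨μ, hμ, fun {n} _ τ θ => ?_⟩
  have hτ (j : n) : τ j ∈ Finset.univ.image τ := Finset.mem_image_of_mem τ (Finset.mem_univ j)
  rw [← sum_single_eq _ (support_sum_single_subset hτ θ), ← hch, ← hmap,
    ch_map (Finset.measurable_restrict _).aemeasurable (measurable_lin _)]
  congr 1 with x
  exact (lin_comp_eq hτ θ x).symm

end Construction

/-! ### From characteristic functions to convergence in probability -/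

section Convergence

variable {Ω T : Type*} [MeasurableSpace Ω] {P : Measure Ω} [IsProbabilityMeasure P]

theorem charFun_map_eq_ch {P : Measure Ω} {Y : Ω → ℝ} (hY : Measurable Y) (r : ℝ) :
    charFun (P.map Y) r = ch P fun ω => r * Y ω := by
  rw [charFun_apply_real, integral_map hY.aemeasurable (by fun_prop), ch]
  congr 1 with ω
  push_cast
  ring_nf

/-- Convergence to zero in distribution implies convergence in probability. -/
theorem tendstoInMeasure_of_ch {l : Filter T} [l.IsCountablyGenerated] {Y : T → Ω → ℝ}
    {Z : Ω → ℝ} (hY : ∀ t, Measurable (Y t)) (hZ : Measurable Z)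
    (h : ∀ r : ℝ, Tendsto (fun t => ch P fun ω => r * (Y t ω - Z ω)) l (𝓝 1)) :
    TendstoInMeasure P Y l Z := by
  refine tendstoInMeasure_iff_measureReal_norm.2 fun ε hε => ?_
  have hD (t : T) : Measurable fun ω => Y t ω - Z ω := (hY t).sub hZ
  have (t : T) := Measure.isProbabilityMeasure_map (μ := P) (hD t).aemeasurable
  -- The truncation inequality bounds a strict tail, so a level strictly below ε is used to cover
  -- the event with ≥ ε.
  set r := ε / 2
  have hr : 0 < r := by positivity
  have hlim : Tendsto (fun t => 2⁻¹ * r * ‖∫ x in (-2 * r⁻¹)..(2 * r⁻¹),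
      1 - charFun (P.map fun ω => Y t ω - Z ω) x‖) l
      (𝓝 (2⁻¹ * r * ‖∫ _ in (-2 * r⁻¹)..(2 * r⁻¹), (0 : ℂ)‖)) := by
    refine Tendsto.const_mul _ (Tendsto.norm ?_)
    refine intervalIntegral.tendsto_integral_filter_of_dominated_convergence (fun _ => 2)
      (Eventually.of_forall fun t => by fun_prop) (Eventually.of_forall fun t =>
        ae_of_all _ fun x _ => norm_one_sub_charFun_le_two) (by simp) (ae_of_all _ fun x _ => ?_)
    simp_rw [charFun_map_eq_ch (hD _)]
    simpa using (h x).const_sub 1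
  simp only [intervalIntegral.integral_zero, norm_zero, mul_zero] at hlim
  refine squeeze_zero (fun t => measureReal_nonneg) (fun t => ?_) hlim
  refine le_trans ?_ (measureReal_abs_gt_le_integral_charFun hr)
  have hs : MeasurableSet {x : ℝ | r < |x|} :=
    measurableSet_lt measurable_const continuous_abs.measurable
  rw [map_measureReal_apply (hD t) hs]
  refine measureReal_mono fun ω hω => ?_
  simp only [Set.mem_ofPred_eq, Real.norm_eq_abs, Set.preimage_ofPred_eq] at hω ⊢
  exact (half_lt_self hε).trans_le hω

end Convergence

/-! ### Properties of the non-Gaussian part -/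

section NonGaussianPart

variable {Ω Ω' : Type*} [MeasurableSpace Ω] [MeasurableSpace Ω'] {P : Measure Ω}
  {X : ℝ≥0 → Ω → ℝ} {P' : Measure Ω'} {η : ℝ≥0 → Ω' → ℝ}

theorem eqFDD_of_fdch [IsProbabilityMeasure P] [IsProbabilityMeasure P']
    (hX : ∀ t, Measurable (X t)) (hη : ∀ t, Measurable (η t))
    (h : ∀ (I : Finset ℝ≥0) (θ : I → ℝ),
      fdch P X (fun i : I => i) θ = fdch P' η (fun i : I => i) θ) : EqFDD X P η P' :=
  fun I => identDistrib_of_ch (measurable_vec hX fun i : I => i)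
    (measurable_vec hη fun i : I => i) (h I)

/-- The process `η` is the non-Gaussian part of `X`: its finite-dimensional characteristic
functions are those of `X` with the Gaussian factor removed. -/
def IsNonGaussianPart (P : Measure Ω) (X : ℝ≥0 → Ω → ℝ) (P' : Measure Ω')
    (η : ℝ≥0 → Ω' → ℝ) : Prop :=
  ∀ {n : Type} [Fintype n] (τ : n → ℝ≥0) (θ : n → ℝ), fdch P' η τ θ = fdch P X τ θ *
    Complex.exp ((gaussVar P (fun ω => lin θ fun i => X (τ i) ω) / 2 : ℝ) : ℂ)

theorem IsNonGaussianPart.hasNoGaussianComponent (h : IsTimeStable X P)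
    (hη : ∀ t, Measurable (η t)) (hp : IsNonGaussianPart P X P' η) :
    HasNoGaussianComponent η P' := by
  intro I
  obtain ⟨b, ν, hν0, hν, hb⟩ := h.exists_fdch_mul_exp_eq fun i : I => (i : ℝ≥0)
  refine ⟨b, ν, Matrix.PosSemidef.zero, hν0, hν, fun θ => ?_⟩
  have h1 := ch_map (P := P') (X := fun ω (i : I) => η i ω)
    (measurable_vec hη fun i : I => (i : ℝ≥0)).aemeasurable (measurable_lin θ)
  exact h1.trans ((hp (fun i : I => (i : ℝ≥0)) θ).trans (hb θ))

/-- For the increment between s and t, the factor from X tends to 1 by stochastic continuity, and 0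
≤ `gaussVar` ≤ -2 log |φ| squeezes the Gaussian correction to 1 as well. -/
theorem IsNonGaussianPart.stochasticallyContinuous [IsProbabilityMeasure P']
    (h : IsTimeStable X P) (hη : ∀ t, Measurable (η t)) (hp : IsNonGaussianPart P X P' η) :
    StochasticallyContinuous η P' := by
  have := h.isProbabilityMeasure
  intro t
  refine tendstoInMeasure_of_ch hη (hη t) fun r => ?_
  have hch (s : ℝ≥0) : ch P' (fun ω => r * (η s ω - η t ω)) = fdch P' η ![s, t] ![r, -r] := by
    rw [fdch]
    congr 1 with ω
    rw [lin_comp_pair]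
    ring
  simp_rw [hch]
  simp_rw [fun s => hp ![s, t] ![r, -r]]
  have h1 : Tendsto (fun s => fdch P X ![s, t] ![r, -r]) (𝓝 t) (𝓝 1) := by
    have hlim := tendsto_fdch h.measurable h.stochasticallyContinuous (σ := fun s => ![s, t])
      (l := 𝓝 t) (τ := ![t, t]) (fun j => by
        fin_cases j
        · exact tendsto_id
        · exact tendsto_const_nhds) ![r, -r]
    convert hlim
    rw [fdch]
    simp_rw [lin_comp_pair]
    simp [ch_zero]
  have h2 : Tendsto (fun s => gaussVar P
      (fun ω => lin ![r, -r] fun i => X (![s, t] i) ω)) (𝓝 t) (𝓝 0) := by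
    refine tendsto_of_tendsto_of_tendsto_of_le_of_le tendsto_const_nhds ?_
      (fun s => h.gaussVar_nonneg ![s, t] ![r, -r]) (fun s => h.gaussVar_le ![s, t] ![r, -r])
    simpa using (h1.norm.log (by simp)).const_mul (-2)
  have h3 : Tendsto (fun s => Complex.exp ((gaussVar P
      (fun ω => lin ![r, -r] fun i => X (![s, t] i) ω) / 2 : ℝ) : ℂ)) (𝓝 t) (𝓝 1) := by
    have hc : Continuous fun x : ℝ => Complex.exp ((x / 2 : ℝ) : ℂ) := by fun_prop
    simpa [Function.comp_def] using (hc.tendsto 0).comp h2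
  simpa using h1.mul h3

/-- Under t ↦ n t the characteristic function of X is raised to the power n and its Gaussian
variance is multiplied by n, so the product is raised to the power n. -/
theorem IsNonGaussianPart.isTimeStable [IsProbabilityMeasure P']
    (h : IsTimeStable X P) (hη : ∀ t, Measurable (η t)) (hp : IsNonGaussianPart P X P' η) :
    IsTimeStable η P' where
  isProbabilityMeasure := inferInstance
  measurable := hη
  stochasticallyContinuous := hp.stochasticallyContinuous h hη
  stable n hn := by
    refine eqFDD_of_fdch (fun t => ?_) (fun t => hη _) fun I θ => ?_
    · unfold sumOfCopies
      exact Finset.measurable_sum _ fun i _ => (hη t).comp (measurable_pi_apply i)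
    · rw [fdch_sumOfCopies, hp]
      have h1 := hp (fun i : I => (n : ℝ≥0) * i) θ
      have h2 := h.fdch_mul (fun i : I => (i : ℝ≥0)) θ n 1 (by lia)
      simp only [mul_one, one_mul] at h2
      rw [h.gaussVar_mul, h2] at h1
      rw [mul_pow, ← Complex.exp_nat_mul]
      refine Eq.trans ?_ h1.symm
      push_cast
      ring_nf

end NonGaussianPart

/-- Both functionals are evaluated at the single random variable ∑ θ_j X(τ_j), the image of the
coefficient vector under `Finsupp.linearCombination`; this is the consistency that
`exists_measure_of_isCharFun` needs. -/
theorem exists_gaussian_nonGaussian_parts {Ω : Type*} [MeasurableSpace Ω] {P : Measure Ω}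
    {X : ℝ≥0 → Ω → ℝ} (h : IsTimeStable X P) :
    ∃ μ ν : Measure (ℝ≥0 → ℝ), IsProbabilityMeasure μ ∧ IsProbabilityMeasure ν ∧
      (∀ {n : Type} [Fintype n] (τ : n → ℝ≥0) (θ : n → ℝ), fdch μ (fun t x => x t) τ θ =
        Complex.exp ((-gaussVar P (fun ω => lin θ fun i => X (τ i) ω) / 2 : ℝ) : ℂ)) ∧
      IsNonGaussianPart P X ν (fun t x => x t) := by
  classical
  have hlc {n : Type} [Fintype n] (τ : n → ℝ≥0) (θ : n → ℝ) :
      Finsupp.linearCombination ℝ X (∑ j, Finsupp.single (τ j) (θ j)) =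
        fun ω => lin θ fun i => X (τ i) ω := by
    ext ω
    simp [lin, Finsupp.linearCombination_single]
  obtain ⟨μ, hμ, hμch⟩ := exists_measure_of_isCharFun (T := ℝ≥0)
    (fun f => Complex.exp ((-gaussVar P (Finsupp.linearCombination ℝ X f) / 2 : ℝ) : ℂ))
    fun I => by
      simp_rw [hlc, h.gaussVar_eq]
      exact ⟨_, Measure.isProbabilityMeasure_map
        (EuclideanSpace.equiv I ℝ).continuous.measurable.aemeasurable,
        ch_multivariateGaussian (h.posSemidef_gaussMatrix fun i : I => (i : ℝ≥0))⟩
  obtain ⟨ν, hν, hνch⟩ := exists_measure_of_isCharFun (T := ℝ≥0)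
    (fun f => ch P (Finsupp.linearCombination ℝ X f) *
      Complex.exp ((gaussVar P (Finsupp.linearCombination ℝ X f) / 2 : ℝ) : ℂ))
    fun I => by
      simp_rw [hlc]
      exact h.isCharFun_fdch_mul_exp fun i : I => (i : ℝ≥0)
  simp_rw [hlc] at hμch hνch
  exact ⟨μ, ν, hμ, hν, hμch, hνch⟩

end

end TimeStable

/-! ### Independent assembly on a product space -/

theorem theorem2p2 {Ω : Type*} [MeasurableSpace Ω] (P : Measure Ω) (ξ : ℝ≥0 → Ω → ℝ)
    (hξ : TimeStable.IsTimeStable ξ P) :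
    ∃ (c : ℝ) (C : ℝ≥0 → ℝ≥0 → ℝ)
      (Ω' : Type) (_ : MeasurableSpace Ω') (P' : Measure Ω') (G η : ℝ≥0 → Ω' → ℝ),
      IsProbabilityMeasure P' ∧
      TimeStable.IsCentredGaussian G C P' ∧
      (∀ u t s : ℝ≥0, C (u * t) (u * s) = (u : ℝ) * C t s) ∧
      TimeStable.IsTimeStable η P' ∧
      TimeStable.HasNoGaussianComponent η P' ∧
      IndepFun (fun ω t => G t ω) (fun ω t => η t ω) P' ∧
      TimeStable.EqFDD ξ P (fun t ω => c * (t : ℝ) + G t ω + η t ω) P' := by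
  have := hξ.isProbabilityMeasure
  obtain ⟨μ, ν, hμ, hν, hG, hη⟩ := TimeStable.exists_gaussian_nonGaussian_parts hξ
  have hGm (t : ℝ≥0) : Measurable fun ω : (ℝ≥0 → ℝ) × (ℝ≥0 → ℝ) => ω.1 t := by fun_prop
  have hηm (t : ℝ≥0) : Measurable fun ω : (ℝ≥0 → ℝ) × (ℝ≥0 → ℝ) => ω.2 t := by fun_prop
  have hfst {n : Type} [Fintype n] (τ : n → ℝ≥0) (θ : n → ℝ) :
      TimeStable.fdch (μ.prod ν) (fun t ω => ω.1 t) τ θ =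
        TimeStable.fdch μ (fun t x => x t) τ θ := by
    have hm : Measurable fun x : ℝ≥0 → ℝ => TimeStable.lin θ fun i => x (τ i) :=
      (TimeStable.measurable_lin θ).comp (by fun_prop)
    have := TimeStable.ch_map (P := μ.prod ν) measurable_fst.aemeasurable hm
    rw [Measure.map_fst_prod, measure_univ, one_smul] at this
    exact this.symm
  have hsnd {n : Type} [Fintype n] (τ : n → ℝ≥0) (θ : n → ℝ) :
      TimeStable.fdch (μ.prod ν) (fun t ω => ω.2 t) τ θ =
        TimeStable.fdch ν (fun t x => x t) τ θ := by
    have hm : Measurable fun x : ℝ≥0 → ℝ => TimeStable.lin θ fun i => x (τ i) :=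
      (TimeStable.measurable_lin θ).comp (by fun_prop)
    have := TimeStable.ch_map (P := μ.prod ν) measurable_snd.aemeasurable hm
    rw [Measure.map_snd_prod, measure_univ, one_smul] at this
    exact this.symm
  have hpart : TimeStable.IsNonGaussianPart P ξ (μ.prod ν) (fun t ω => ω.2 t) :=
    fun τ θ => (hsnd τ θ).trans (hη τ θ)
  -- The drift is allowed in η, so no linear term has to be split off and c = 0.
  refine ⟨0, TimeStable.gaussCov P ξ, (ℝ≥0 → ℝ) × (ℝ≥0 → ℝ), inferInstance, μ.prod ν,
    fun t ω => ω.1 t, fun t ω => ω.2 t, inferInstance, ?_, hξ.gaussCov_mul,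
    hpart.isTimeStable hξ hηm, hpart.hasNoGaussianComponent hξ hηm,
    indepFun_prod measurable_id measurable_id, ?_⟩
  · refine TimeStable.isCentredGaussian_of_fdch hGm (fun τ => hξ.posSemidef_gaussMatrix τ)
      fun τ θ => ?_
    rw [hfst, hG, hξ.gaussVar_eq]
    rfl
  · refine TimeStable.eqFDD_of_fdch hξ.measurable (fun t => by fun_prop) fun I θ => ?_
    have h1 := TimeStable.ch_prod_add μ ν (fun x => TimeStable.lin θ fun i => x i)
      fun x => TimeStable.lin θ fun i => x i
    have h2 := hG (fun i : I => (i : ℝ≥0)) θ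
    have h3 := hη (fun i : I => (i : ℝ≥0)) θ
    rw [TimeStable.fdch] at h2 h3
    -- The Gaussian factor exp(-v/2) of G cancels the exp(v/2) built into η, leaving the
    -- characteristic function of ξ.
    rw [h2, h3, mul_left_comm, ← Complex.exp_add, ← Complex.ofReal_add, neg_div, neg_add_cancel,
      Complex.ofReal_zero, Complex.exp_zero, mul_one] at h1
    rw [← h1, TimeStable.fdch]
    congr 1 with ω
    rw [← TimeStable.lin_add]
    congr 1 with i
    simp
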